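/- Let $0<\alpha\le 1$, $\omega\ge 0$, $\varepsilon\ge 0$, $\sigma>0$, $\lambda>0$, $A_0,\Omega\in\mathbb R$, $N\in\mathbb N$. Let $D^\alpha$ denote the Caputo derivative, $D^\alpha f(t)=\frac1{\Gamma(1-\alpha)}\int_0^t (t-\tau)^{-\alpha}f'(\tau)\,d\tau$ for $\alpha<1$ and $D^1f=f'$. On a filtered probability space with expectation $\langle\cdot\rangle$, let $(\xi_t)_{t\ge0}$ be a (measurable, adapted) symmetric dichotomous noise, i.e. a Markov process with respect to the filtration, with values $\pm\sigma$, $\langle\xi_t\rangle=0$ and $\langle\xi_t\xi_\tau\rangle=\sigma^2e^{-\lambda|t-\tau|}$. Let $x_0$ (main particle) and $x_1,\dots,x_N$ (peripheral particles) be adapted processes with integrable initial values and locally absolutely continuous paths which satisfy, almost surely and for almost every $t\ge0$, $$D^\alpha x_0+(\omega+\xi_t)x_0=\varepsilon\sum_{i=1}^N(x_i-x_0)+A_0\sin(\Omega t),$$ $$D^\alpha x_n+(\omega+\xi_t)x_n=\varepsilon(x_0-x_n)+A_0\sin(\Omega t),\qquad 1\le n\le N.$$ Put $S=\frac1{N+1}\sum_{i=0}^N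 x_i$, $\Delta_n=x_n-S$ for $0\le n\le N$, and $\sigma_s^2:=(\omega+\varepsilon)^2+\lambda^\alpha(\omega+\varepsilon)$. Then: 1. For $1\le n\le N$, almost surely and for almost every $t\ge0$, $D^\alpha\Delta_n+(\omega+\xi_t+\varepsilon)\Delta_n=\varepsilon\Delta_0$. In particular, at almost every time $t$ at which the main particle is synchronized with the mean field, $x_0(t)=S(t)$, one has $$D^\alpha\Delta_n+(\omega+\xi_t+\varepsilon)\Delta_n=0.$$ 2. If $\sigma^2<\sigma_s^2$, then every adapted process $\Delta$ with integrable initial value and locally absolutely continuous paths which satisfies $D^\alpha\Delta+(\omega+\xi_t+\varepsilon)\Delta=0$ almost surely for almost every $t\ge 0$ is integrable at all times $t\ge 0$, and $\langle\Delta(t)\rangle\to0$ as $t\to\infty$. 3. If $\sigma^2<\sigma_s^2$, then the synchronization criterion of the main particle holds: $$\sigma^2<[\omega+\varepsilon(N+1)]^2+\lambda^\alpha[\omega+\varepsilon(N+1)].$$ 4. If $\sigma^2<\sigma_s^2$, then every particle synchronizes in mean with the mean field: for all $0\le n\le N$, $\Delta_n(t)$ is integrable for every $t\ge 0$ and $\langle\Delta_n(t)\rangle\to0$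 as $t\to\infty$. -/

import Mathlib

open MeasureTheory ProbabilityTheory Filter Topology

noncomputable section

/-- The Caputo derivative of order `α ∈ (0, 1]` based at `0`. For `α < 1` it is
`Γ(1-α)⁻¹ ∫₀ᵗ (t-τ)^(-α) f'(τ) dτ`; for `α = 1` it is the ordinary derivative. It is only
applied to (locally) absolutely continuous functions. -/
def caputoDeriv (α : ℝ) (f : ℝ → ℝ) (t : ℝ) : ℝ :=
  if α = 1 then deriv f t
  else (1 / Real.Gamma (1 - α)) * ∫ τ in (0 : ℝ)..t, (t - τ) ^ (-α) * deriv f τ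

/-- Symmetric dichotomous Markov noise (random telegraph noise) on times `t ≥ 0`, with values
`±σ`, zero mean and correlation function `σ² exp(-lam |t-s|)`; it is adapted to the filtration
`F`, and Markov with respect to it. -/
structure IsDichotomousNoise {Ω : Type*} {m : MeasurableSpace Ω} (μ : Measure Ω)
    (F : Filtration ℝ m) (σ lam : ℝ) (ξ : ℝ → Ω → ℝ) : Prop where
  measurable : Measurable (fun p : Set.Ici (0 : ℝ) × Ω => ξ p.1 p.2)
  adapted : ∀ t, 0 ≤ t → Measurable[F t] (ξ t)
  values : ∀ t, 0 ≤ t → ∀ w, ξ t w = σ ∨ ξ t w = -σ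
  markov : ∀ s t, 0 ≤ s → s ≤ t → ∀ B : Set ℝ, MeasurableSet B →
    μ⟦ξ t ⁻¹' B | F s⟧ =ᵐ[μ] μ⟦ξ t ⁻¹' B | MeasurableSpace.comap (ξ s) (borel ℝ)⟧
  mean : ∀ t, 0 ≤ t → ∫ w, ξ t w ∂μ = 0
  correlation : ∀ s t, 0 ≤ s → 0 ≤ t →
    ∫ w, ξ t w * ξ s w ∂μ = σ ^ 2 * Real.exp (-lam * |t - s|)

/-- A finite family of real processes on times `t ≥ 0` that does not anticipate the noise
(adapted to `F`), has integrable initial values and locally absolutely continuous paths, so that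
pathwise Caputo derivatives make sense. -/
structure IsAdmissible {Ω : Type*} {m : MeasurableSpace Ω} (μ : Measure Ω)
    (F : Filtration ℝ m) {ι : Type*} (x : ι → ℝ → Ω → ℝ) : Prop where
  adapted : ∀ i t, 0 ≤ t → Measurable[F t] (x i t)
  integrable_zero : ∀ i, Integrable (x i 0) μ
  absolutelyContinuous : ∀ i, ∀ᵐ w ∂μ, ∀ T, 0 ≤ T →
    AbsolutelyContinuousOnInterval (fun t => x i t w) 0 T

/-- Solutions of the star-coupled fractional system with main particle `x 0` and peripheral
particles `x 1, …, x N`: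
`D^α x₀ + (ω + ξ) x₀ = ε ∑ₖ (xₖ - x₀) + A₀ sin(Ω₀ t)` and
`D^α xₖ + (ω + ξ) xₖ = ε (x₀ - xₖ) + A₀ sin(Ω₀ t)` for `1 ≤ k ≤ N`. -/
structure IsStarSolution {Ω : Type*} {m : MeasurableSpace Ω} (μ : Measure Ω)
    (F : Filtration ℝ m) (N : ℕ) (α ω ε A₀ Ω₀ : ℝ) (ξ : ℝ → Ω → ℝ)
    (x : Fin (N + 1) → ℝ → Ω → ℝ) : Prop where
  admissible : IsAdmissible μ F x
  main : ∀ᵐ w ∂μ, ∀ᵐ t ∂(volume.restrict (Set.Ici (0 : ℝ))),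
    caputoDeriv α (fun s => x 0 s w) t + (ω + ξ t w) * x 0 t w
      = ε * ∑ k : Fin N, (x k.succ t w - x 0 t w) + A₀ * Real.sin (Ω₀ * t)
  peripheral : ∀ k : Fin N, ∀ᵐ w ∂μ, ∀ᵐ t ∂(volume.restrict (Set.Ici (0 : ℝ))),
    caputoDeriv α (fun s => x k.succ s w) t + (ω + ξ t w) * x k.succ t w
      = ε * (x 0 t w - x k.succ t w) + A₀ * Real.sin (Ω₀ * t)

/-- The mean field `S = (x₀ + ⋯ + x_N) / (N + 1)`. -/
def meanField {Ω : Type*} {N : ℕ} (x : Fin (N + 1) → ℝ → Ω → ℝ) (t : ℝ) (w : Ω) : ℝ :=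
  (∑ i, x i t w) / ((N : ℝ) + 1)

/-- The deviation `Δᵢ = xᵢ - S` of the `i`-th particle from the mean field. -/
def deviation {Ω : Type*} {N : ℕ} (x : Fin (N + 1) → ℝ → Ω → ℝ) (i : Fin (N + 1))
    (t : ℝ) (w : Ω) : ℝ :=
  x i t w - meanField x t w

/-- Solutions `Δ` of the homogeneous equation `D^α Δ + (a + ξ) Δ = 0`. -/
structure IsHomogeneousSolution {Ω : Type*} {m : MeasurableSpace Ω} (μ : Measure Ω)
    (F : Filtration ℝ m) (α a : ℝ) (ξ : ℝ → Ω → ℝ) (Δ : ℝ → Ω → ℝ) : Prop where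
  admissible : IsAdmissible μ F (fun _ : Unit => Δ)
  equation : ∀ᵐ w ∂μ, ∀ᵐ t ∂(volume.restrict (Set.Ici (0 : ℝ))),
    caputoDeriv α (fun s => Δ s w) t + (a + ξ t w) * Δ t w = 0

/-- The process `Δ` has a mean at all times `t ≥ 0`, and `⟨Δ(t)⟩ → 0` as `t → ∞`. -/
def MeanTendstoZero {Ω : Type*} {m : MeasurableSpace Ω} (μ : Measure Ω)
    (Δ : ℝ → Ω → ℝ) : Prop :=
  (∀ t, 0 ≤ t → Integrable (Δ t) μ) ∧ Tendsto (fun t => ∫ w, Δ t w ∂μ) atTop (𝓝 0)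

/-- The global synchronization threshold `σ_s² = (ω + ε)² + lam^α (ω + ε)`. -/
def globalSyncThreshold (α ω ε lam : ℝ) : ℝ :=
  (ω + ε) ^ 2 + lam ^ α * (ω + ε)

end

/-! Linear algebra reduces the network to one stochastic equation. The coupling forces of the star
sum to zero and the drive is common to all particles, so the deviations satisfy a closed linear
system. The matrix of this system has simple eigenvectors: `Δ₀` is damped by an extra `ε(N+1)`, and
`Δₖ + Δ₀/N` by an extra `ε`. Each of these combinations solves `D^α Δ + (a + ξ)Δ = 0` with `a ≥ ω +
ε`. Since `a² + lam^α a` increases with `a`, one theorem about this equation settles every particle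
(`IsHomogeneousSolution.meanTendstoZero`).

For that theorem the equation is inverted pathwise to `Δ = Δ(0) - k * ((a + ξ)Δ)`, where `k(t) =
t^(α-1)/Γ(α)` (`LocallyAC.eq_add_volterraConv`). Put `u = ⟨Δ⟩` and `z = ⟨ξΔ⟩`. Testing the integral
equation at time `t` with `1` gives `u = u(0) - k * (a u + z)`. Testing it with `ξ_t`, and using
`⟨ξ_t Y⟩ = e^(-lam(t-s))⟨ξ_s Y⟩` for `Y` known at time `s` together with `ξ² = σ²`, gives `z =
z(0)e^(-lam t) - k_lam * (a z + σ² u)`, where `k_lam(t) = e^(-lam t) k(t)`. So two moments form a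
closed deterministic system.

Decay of this system is a small-gain argument. For a scalar equation `u = c g - κ * (a u + f)` the
aim is `(a + b) limsup |u| ≤ limsup |f|`, with `b = 0` for `k` and `b = lam^α` for `k_lam`. The
memory rules out a local comparison argument; balayage replaces it. For every lag `L` there is a
positive measure `ν` on `[0, ∞)` with `κ(L + x) = ∫ κ(x - y) ν(dy)` and mass at most `1 - bK`, where
`K = ∫₀ᴸ κ`. Hence the past as seen from `t + L` is a `ν`-average of the past as seen from earlier
times, and up to vanishing free terms `(1 + aK)|u(t+L)| ≤ ∫ |u(t-y)| ν(dy) + K|f| + O(K²)`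
(`IsVolterraSolution.step`). Small `L` gives the gain. The loop closes when `σ² < a(a + lam^α)`,
which is the threshold. -/

/-! ### Causal kernels and their convolutions -/

/-- A causal convolution kernel: nonnegative, supported on `(0, ∞)`, nonincreasing there, and
integrable near `0`. -/
structure IsVolterraKernel (κ : ℝ → ℝ) : Prop where
  measurable : Measurable κ
  nonneg : ∀ x, 0 ≤ κ x
  eq_zero : ∀ x, x ≤ 0 → κ x = 0
  antitone : AntitoneOn κ (Set.Ioi 0)
  integrable : ∀ L, IntegrableOn κ (Set.Iio L)

/-- The primitive of a causal kernel. -/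
noncomputable def kernelMass (κ : ℝ → ℝ) (L : ℝ) : ℝ := ∫ x in Set.Iio L, κ x

/-- The causal convolution `∫₀ᵗ κ(t-s) v(s) ds`. -/
noncomputable def volterraConv (κ v : ℝ → ℝ) (t : ℝ) : ℝ :=
  ∫ s in Set.Ioi (0 : ℝ), κ (t - s) * v s

theorem setIntegral_comp_sub_eq_kernelMass (κ : ℝ → ℝ) (t a : ℝ) :
    ∫ s in Set.Ioi a, κ (t - s) = kernelMass κ (t - a) := by
  unfold kernelMass
  rw [← integral_indicator measurableSet_Iio, ← integral_indicator measurableSet_Ioi,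
    ← integral_sub_left_eq_self _ volume t]
  congr 1
  ext s
  simp [Set.indicator, lt_sub_comm]

namespace IsVolterraKernel

variable {κ v : ℝ → ℝ} (hκ : IsVolterraKernel κ)
include hκ

theorem integrableOn_comp_sub (t a : ℝ) : IntegrableOn (fun s => κ (t - s)) (Set.Ioi a) := by
  have h := (hκ.integrable (t - a))
  rw [← integrable_indicator_iff measurableSet_Iio] at h
  have h2 := h.comp_sub_left t
  rw [← integrable_indicator_iff measurableSet_Ioi]
  refine h2.congr (Eventually.of_forall fun s => ?_)
  simp [Set.indicator, sub_lt_sub_iff_left]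

theorem kernelMass_nonneg (L : ℝ) : 0 ≤ kernelMass κ L :=
  integral_nonneg fun x => hκ.nonneg x

theorem kernelMass_mono {L L' : ℝ} (h : L ≤ L') : kernelMass κ L ≤ kernelMass κ L' :=
  setIntegral_mono_set (hκ.integrable L') (Eventually.of_forall fun x => hκ.nonneg x)
    (Set.Iio_subset_Iio h).eventuallyLE

theorem kernelMass_of_nonpos {L : ℝ} (h : L ≤ 0) : kernelMass κ L = 0 := by
  unfold kernelMass
  rw [setIntegral_congr_fun (g := fun _ => (0 : ℝ)) measurableSet_Iio
    (fun x hx => hκ.eq_zero x ((le_of_lt hx).trans h))]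
  simp

/-- Dominated convergence. This is what makes errors proportional to the mass of a short lag
negligible in the gain estimates, and it yields the continuity of convolutions. -/
theorem tendsto_kernelMass : Tendsto (kernelMass κ) (𝓝 0) (𝓝 0) := by
  have h1 : ∀ L, L ∈ Set.Iic (1 : ℝ) → kernelMass κ L = ∫ x in Set.Iio (1 : ℝ),
      (Set.Iio L).indicator κ x := by
    intro L hL
    rw [setIntegral_indicator measurableSet_Iio,
      Set.inter_eq_right.2 (Set.Iio_subset_Iio hL)]
    rfl
  have h2 : Tendsto (fun L : ℝ => ∫ x in Set.Iio (1 : ℝ), (Set.Iio L).indicator κ x) (𝓝 0)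
      (𝓝 (∫ x in Set.Iio (1 : ℝ), (0 : ℝ))) := by
    refine tendsto_integral_filter_of_dominated_convergence κ
      (Eventually.of_forall fun L =>
        (hκ.measurable.indicator measurableSet_Iio).aestronglyMeasurable)
      (Eventually.of_forall fun L => Eventually.of_forall fun x => ?_) (hκ.integrable 1)
      (Eventually.of_forall fun x => ?_)
    · rw [Real.norm_of_nonneg (Set.indicator_nonneg (fun x _ => hκ.nonneg x) x)]
      exact Set.indicator_le_self' (fun x _ => hκ.nonneg x) x
    · rcases le_or_gt x 0 with hx | hx
      · have : ∀ L, (Set.Iio L).indicator κ x = 0 := fun L => by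
          simp [Set.indicator, hκ.eq_zero x hx]
        simp [this]
      · refine tendsto_const_nhds.congr' ?_
        filter_upwards [Iio_mem_nhds hx] with L hL
        have hL' : ¬ x < L := not_lt.2 (le_of_lt hL)
        simp [Set.indicator, hL']
  simp only [integral_zero] at h2
  refine h2.congr' ?_
  filter_upwards [Iic_mem_nhds (zero_lt_one' ℝ)] with L hL
  exact (h1 L hL).symm

theorem norm_mul_le {t V a : ℝ} (hV : ∀ s, a < s → s < t → |v s| ≤ V) (s : ℝ) (hs : a < s) :
    ‖κ (t - s) * v s‖ ≤ κ (t - s) * V := by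
  rw [norm_mul, Real.norm_of_nonneg (hκ.nonneg _), Real.norm_eq_abs]
  rcases lt_or_ge s t with h | h
  · exact mul_le_mul_of_nonneg_left (hV s hs h) (hκ.nonneg _)
  · simp [hκ.eq_zero (t - s) (by linarith)]

theorem integrableOn_mul (hv : Measurable v) {t V a : ℝ} (hV : ∀ s, a < s → s < t → |v s| ≤ V) :
    IntegrableOn (fun s => κ (t - s) * v s) (Set.Ioi a) := by
  refine Integrable.mono' ((hκ.integrableOn_comp_sub t a).mul_const V)
    ((hκ.measurable.comp (measurable_const.sub measurable_id)).mul hv).aestronglyMeasurable ?_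
  exact (ae_restrict_iff' measurableSet_Ioi).2
    (Eventually.of_forall fun s hs => hκ.norm_mul_le hV s hs)

theorem abs_integral_mul_le {t V a : ℝ} (hV : ∀ s, a < s → s < t → |v s| ≤ V) :
    |∫ s in Set.Ioi a, κ (t - s) * v s| ≤ kernelMass κ (t - a) * V := by
  rw [← setIntegral_comp_sub_eq_kernelMass, ← integral_mul_const, ← Real.norm_eq_abs]
  refine norm_integral_le_of_norm_le ((hκ.integrableOn_comp_sub t a).mul_const V) ?_
  exact (ae_restrict_iff' measurableSet_Ioi).2
    (Eventually.of_forall fun s hs => hκ.norm_mul_le hV s hs)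

theorem volterraConv_of_nonpos {t : ℝ} (ht : t ≤ 0) : volterraConv κ v t = 0 := by
  unfold volterraConv
  rw [setIntegral_congr_fun (g := fun _ => (0 : ℝ)) measurableSet_Ioi]
  · simp
  · intro s hs
    have : (0 : ℝ) < s := hs
    simp [hκ.eq_zero (t - s) (by linarith)]

/-- Modulus of continuity of a causal convolution with bounded density. -/
theorem abs_volterraConv_sub_le (hv : Measurable v) {s t V : ℝ} (hs : 0 ≤ s) (hst : s ≤ t)
    (hV : ∀ r, 0 < r → r < t → |v r| ≤ V) :
    |volterraConv κ v s - volterraConv κ v t| ≤ 2 * kernelMass κ (t - s) * V := by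
  rcases eq_or_lt_of_le (hs.trans hst) with h0 | h0
  · have : s = t := by linarith
    subst this
    simp [hκ.kernelMass_of_nonpos le_rfl]
  have hV0 : 0 ≤ V := (abs_nonneg _).trans (hV (t / 2) (by linarith) (by linarith))
  have hVs : ∀ r, 0 < r → r < s → |v r| ≤ V := fun r h1 h2 => hV r h1 (h2.trans_le hst)
  unfold volterraConv
  rw [← integral_sub (hκ.integrableOn_mul hv hVs) (hκ.integrableOn_mul hv hV)]
  have hI1 := (hκ.integrableOn_comp_sub s 0)
  have hI2 := (hκ.integrableOn_comp_sub t 0)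
  have hI12 : IntegrableOn (fun r => κ (s - r) - κ (t - r)) (Set.Ioi 0) := hI1.sub hI2
  have hI3 : IntegrableOn ((Set.Ioi s).indicator fun r => κ (t - r)) (Set.Ioi 0) :=
    hI2.indicator measurableSet_Ioi
  -- The integrand is `|κ(s-r) - κ(t-r)|` written without absolute values: by monotonicity the
  -- difference is nonnegative for `r < s`, while for `r > s` only `-κ(t-r)` is left and its sign is
  -- flipped by adding it twice.
  have key : ∫ r in Set.Ioi (0 : ℝ), (κ (s - r) - κ (t - r)
      + 2 * (Set.Ioi s).indicator (fun r => κ (t - r)) r) * V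
      = (kernelMass κ s - kernelMass κ t + 2 * kernelMass κ (t - s)) * V := by
    rw [integral_mul_const, integral_add hI12 (hI3.const_mul 2), integral_sub hI1 hI2,
      integral_const_mul, setIntegral_comp_sub_eq_kernelMass, setIntegral_comp_sub_eq_kernelMass,
      setIntegral_indicator measurableSet_Ioi,
      Set.inter_eq_right.2 (Set.Ioi_subset_Ioi hs), setIntegral_comp_sub_eq_kernelMass]
    simp
  calc |∫ r in Set.Ioi (0 : ℝ), (κ (s - r) * v r - κ (t - r) * v r)|
      ≤ ∫ r in Set.Ioi (0 : ℝ), (κ (s - r) - κ (t - r)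
        + 2 * (Set.Ioi s).indicator (fun r => κ (t - r)) r) * V := by
        rw [← Real.norm_eq_abs]
        refine norm_integral_le_of_norm_le
          ((hI12.add (hI3.const_mul 2)).mul_const V) ?_
        have hne : ∀ᵐ r ∂(volume.restrict (Set.Ioi (0 : ℝ))), r ≠ s :=
          ae_restrict_of_ae (by simp [ae_iff, measure_singleton])
        filter_upwards [hne, ae_restrict_mem measurableSet_Ioi] with r hrs hr
        have hr0 : 0 < r := hr
        rw [← sub_mul, norm_mul, Real.norm_eq_abs, Real.norm_eq_abs]
        rcases lt_or_gt_of_ne hrs with h | h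
        · have h1 : κ (t - r) ≤ κ (s - r) :=
            hκ.antitone (show 0 < s - r by linarith) (show 0 < t - r by linarith) (by linarith)
          have h2 : r ∉ Set.Ioi s := not_lt.2 h.le
          rw [Set.indicator_of_notMem h2, abs_of_nonneg (by linarith), mul_zero, add_zero]
          exact mul_le_mul_of_nonneg_left (hV r hr0 (by linarith)) (by linarith)
        · have h2 : r ∈ Set.Ioi s := h
          rw [Set.indicator_of_mem h2, hκ.eq_zero (s - r) (by linarith)]
          have h3 := hκ.nonneg (t - r)
          rw [zero_sub, abs_neg, abs_of_nonneg h3]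
          rcases lt_or_ge r t with h4 | h4
          · nlinarith [mul_le_mul_of_nonneg_left (hV r hr0 h4) h3]
          · simp [hκ.eq_zero (t - r) (by linarith)]
    _ = (kernelMass κ s - kernelMass κ t + 2 * kernelMass κ (t - s)) * V := key
    _ ≤ 2 * kernelMass κ (t - s) * V := by
        have := hκ.kernelMass_mono hst
        exact mul_le_mul_of_nonneg_right (by linarith) hV0

theorem continuousOn_volterraConv (hv : Measurable v)
    (hb : ∀ T, ∃ V, ∀ r, 0 < r → r < T → |v r| ≤ V) :
    ContinuousOn (volterraConv κ v) (Set.Ici 0) := by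
  intro t ht
  obtain ⟨V, hV⟩ := hb (t + 1)
  have ht0 : 0 ≤ t := ht
  have hV0 : 0 ≤ V := (abs_nonneg _).trans (hV ((t + 1) / 2) (by linarith) (by linarith))
  rw [ContinuousWithinAt, tendsto_iff_dist_tendsto_zero]
  have hlim : Tendsto (fun s => 2 * kernelMass κ |s - t| * V) (𝓝[Set.Ici 0] t) (𝓝 0) := by
    have h1 : Tendsto (fun s : ℝ => |s - t|) (𝓝[Set.Ici 0] t) (𝓝 0) := by
      have : Tendsto (fun s : ℝ => |s - t|) (𝓝 t) (𝓝 |t - t|) :=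
        (continuous_abs.comp (continuous_sub_right t)).tendsto t
      simp only [sub_self, abs_zero] at this
      exact this.mono_left nhdsWithin_le_nhds
    have := ((hκ.tendsto_kernelMass.comp h1).const_mul 2).mul_const V
    simpa using this
  refine squeeze_zero' (Eventually.of_forall fun s => dist_nonneg) ?_ hlim
  have hlt : ∀ᶠ s in 𝓝[Set.Ici 0] t, s < t + 1 :=
    nhdsWithin_le_nhds (Iio_mem_nhds (by linarith))
  filter_upwards [self_mem_nhdsWithin, hlt] with s hs hs1
  rw [Real.dist_eq]
  rcases le_total s t with h | h
  · rw [abs_of_nonpos (sub_nonpos.2 h), neg_sub]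
    exact hκ.abs_volterraConv_sub_le hv hs h fun r h1 h2 => hV r h1 (by linarith)
  · rw [abs_of_nonneg (sub_nonneg.2 h), abs_sub_comm]
    exact hκ.abs_volterraConv_sub_le hv ht0 h fun r h1 h2 => hV r h1 (by linarith)

end IsVolterraKernel

/-! ### Balayage of a kernel -/

/-- A measure `ν` on `[0, ∞)` that sweeps the kernel `κ` from time `t + L` back to times `≤ t`:
`κ(L + x) = ∫ κ(x - y) ν(dy)` for `x > 0`. Its total mass is at most `1 - b ∫₀ᴸ κ`, and it
almost preserves the free evolution `g`. -/
structure IsBalayage (κ g : ℝ → ℝ) (b L : ℝ) (ν : Measure ℝ) : Prop where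
  finite : IsFiniteMeasure ν
  nonneg : ∀ᵐ y ∂ν, 0 ≤ y
  kernel : ∀ x, 0 < x → κ (L + x) = ∫ y, κ (x - y) ∂ν
  mass : ν.real Set.univ ≤ 1 - b * kernelMass κ L
  remainder_le : ∀ t, 0 ≤ t → |g (t + L) - ∫ y in Set.Iic t, g (t - y) ∂ν| ≤ 1
  remainder_tendsto :
    Tendsto (fun t => |g (t + L) - ∫ y in Set.Iic t, g (t - y) ∂ν|) atTop (𝓝 0)

/-- A causal kernel with balayage measures at all time lags, and a free evolution `g`. -/
structure IsBalayageKernel (κ g : ℝ → ℝ) (b : ℝ) : Prop where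
  kernel : IsVolterraKernel κ
  mass_pos : ∀ L, 0 < L → 0 < kernelMass κ L
  exists_balayage : ∀ L, 0 < L → ∃ ν, IsBalayage κ g b L ν
  free_continuous : Continuous g
  free_antitone : Antitone g
  free_le : ∀ s t, 0 ≤ s → g s - g t ≤ 1
  free_tendsto : ∀ L, Tendsto (fun t => g t - g (t + L)) atTop (𝓝 0)

/-- For `s < t` the kernel identity at `x = t - s` writes `κ(t + L - s)` as a `ν`-average of `κ(t -
y - s)`; Fubini then turns the contribution of the times up to `t` into an average of earlier values
of the same convolution. Only the short window after `t` has to be treated by hand. -/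
theorem IsBalayage.volterraConv_add {κ g v : ℝ → ℝ} {b L t V : ℝ} {ν : Measure ℝ}
    (hκ : IsVolterraKernel κ) (hν : IsBalayage κ g b L ν) (hL : 0 ≤ L) (ht : 0 ≤ t)
    (hv : Measurable v) (hV : ∀ s, 0 < s → s < t + L → |v s| ≤ V) :
    volterraConv κ v (t + L) = ∫ y, volterraConv κ v (t - y) ∂ν
      + ∫ s in Set.Ioi t, κ (t + L - s) * v s := by
  have := hν.finite
  have hint := hκ.integrableOn_mul hv hV
  have hmeas : Measurable (fun p : ℝ × ℝ => κ (t - p.1 - p.2) * v p.1) :=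
    (hκ.measurable.comp ((measurable_const.sub measurable_fst).sub measurable_snd)).mul
      (hv.comp measurable_fst)
  have hsplit : volterraConv κ v (t + L) = (∫ s in Set.Ioc 0 t, κ (t + L - s) * v s)
      + ∫ s in Set.Ioi t, κ (t + L - s) * v s := by
    unfold volterraConv
    have hd : Disjoint (Set.Ioc 0 t) (Set.Ioi t) :=
      Set.disjoint_left.2 fun s h1 h2 => not_lt.2 h1.2 h2
    rw [← setIntegral_union hd
      measurableSet_Ioi (hint.mono_set Set.Ioc_subset_Ioi_self)
      (hint.mono_set (Set.Ioi_subset_Ioi ht)), Set.Ioc_union_Ioi_eq_Ioi ht]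
  rw [hsplit]
  congr 1
  have hfub : Integrable (fun p : ℝ × ℝ => κ (t - p.1 - p.2) * v p.1)
      ((volume.restrict (Set.Ioc 0 t)).prod ν) := by
    rw [integrable_prod_iff' hmeas.aestronglyMeasurable]
    have hb : ∀ y, 0 ≤ y → ∀ s ∈ Set.Ioc 0 t,
        ‖κ (t - s - y) * v s‖ ≤ κ ((t - y) - s) * V := by
      intro y hy s hs
      rw [norm_mul, Real.norm_of_nonneg (hκ.nonneg _), Real.norm_eq_abs, sub_right_comm]
      rcases lt_or_ge s t with h | h
      · exact mul_le_mul_of_nonneg_left (hV s hs.1 (by linarith)) (hκ.nonneg _)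
      · simp [hκ.eq_zero (t - y - s) (by linarith)]
    have hi : ∀ y, IntegrableOn (fun s => κ ((t - y) - s) * V) (Set.Ioc 0 t) := fun y =>
      ((hκ.integrableOn_comp_sub (t - y) 0).mono_set Set.Ioc_subset_Ioi_self).mul_const V
    constructor
    · filter_upwards [hν.nonneg] with y hy
      refine Integrable.mono' (hi y)
        (hmeas.comp (measurable_id.prodMk measurable_const)).aestronglyMeasurable ?_
      exact (ae_restrict_iff' measurableSet_Ioc).2 (Eventually.of_forall fun s hs => hb y hy s hs)
    · refine Integrable.mono' (integrable_const (kernelMass κ t * |V|))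
        hmeas.aestronglyMeasurable.norm.prod_swap.integral_prod_right' ?_
      filter_upwards [hν.nonneg] with y hy
      rw [Real.norm_of_nonneg (integral_nonneg fun _ => norm_nonneg _)]
      calc ∫ s in Set.Ioc 0 t, ‖κ (t - s - y) * v s‖
          ≤ ∫ s in Set.Ioc 0 t, κ ((t - y) - s) * V :=
            integral_mono_of_nonneg (Eventually.of_forall fun _ => norm_nonneg _) (hi y)
              ((ae_restrict_iff' measurableSet_Ioc).2
                (Eventually.of_forall fun s hs => hb y hy s hs))
        _ = (∫ s in Set.Ioc 0 t, κ ((t - y) - s)) * V := integral_mul_const _ _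
        _ ≤ (∫ s in Set.Ioc 0 t, κ ((t - y) - s)) * |V| :=
            mul_le_mul_of_nonneg_left (le_abs_self V) (integral_nonneg fun _ => hκ.nonneg _)
        _ ≤ kernelMass κ t * |V| := by
            refine mul_le_mul_of_nonneg_right ?_ (abs_nonneg V)
            calc _ ≤ ∫ s in Set.Ioi (0 : ℝ), κ ((t - y) - s) :=
                  setIntegral_mono_set (hκ.integrableOn_comp_sub _ _)
                    (Eventually.of_forall fun _ => hκ.nonneg _)
                    Set.Ioc_subset_Ioi_self.eventuallyLE
              _ = kernelMass κ (t - y - 0) := setIntegral_comp_sub_eq_kernelMass _ _ _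
              _ ≤ kernelMass κ t := hκ.kernelMass_mono (by linarith)
  calc ∫ s in Set.Ioc 0 t, κ (t + L - s) * v s
      = ∫ s in Set.Ioc 0 t, ∫ y, κ (t - s - y) * v s ∂ν := by
        have hne : ∀ᵐ s ∂(volume.restrict (Set.Ioc 0 t)), s ≠ t :=
          ae_restrict_of_ae (by simp [ae_iff, measure_singleton])
        refine integral_congr_ae ?_
        filter_upwards [hne, ae_restrict_mem measurableSet_Ioc] with s h1 h2
        have : 0 < t - s := sub_pos.2 (lt_of_le_of_ne h2.2 h1)
        rw [integral_mul_const, ← hν.kernel _ this]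
        congr 2
        ring
    _ = ∫ y, ∫ s in Set.Ioc 0 t, κ (t - s - y) * v s ∂volume ∂ν := integral_integral_swap hfub
    _ = ∫ y, volterraConv κ v (t - y) ∂ν := by
        refine integral_congr_ae ?_
        filter_upwards [hν.nonneg] with y hy
        unfold volterraConv
        simp only [sub_right_comm t]
        refine (setIntegral_eq_of_subset_of_forall_sdiff_eq_zero measurableSet_Ioi
          Set.Ioc_subset_Ioi_self fun s hs => ?_).symm
        have h1 : t < s := by
          by_contra h
          exact hs.2 ⟨hs.1, not_lt.1 h⟩
        rw [hκ.eq_zero _ (by linarith), zero_mul]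

/-! ### Gain estimates for a scalar Volterra equation -/

/-- `u` solves the linear Volterra equation `u = u(0) g - κ * (a u + f)` on `t ≥ 0`. -/
structure IsVolterraSolution (κ g : ℝ → ℝ) (a : ℝ) (f : ℝ → ℝ) (c : ℝ) (u : ℝ → ℝ) : Prop where
  measurable : Measurable u
  measurable_source : Measurable f
  bounded : ∀ T, ∃ B, ∀ s, 0 ≤ s → s ≤ T → |u s| ≤ B
  bounded_source : ∀ T, ∃ B, ∀ s, 0 ≤ s → s ≤ T → |f s| ≤ B
  equation : ∀ t, 0 ≤ t → u t = c * g t - volterraConv κ (fun s => a * u s + f s) t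

namespace IsVolterraSolution

variable {κ g f u : ℝ → ℝ} {a b c : ℝ}

theorem continuousOn (hκ : IsBalayageKernel κ g b) (h : IsVolterraSolution κ g a f c u) :
    ContinuousOn u (Set.Ici 0) := by
  have h1 : ContinuousOn (fun t => c * g t - volterraConv κ (fun s => a * u s + f s) t)
      (Set.Ici 0) := by
    refine (hκ.free_continuous.const_mul c).continuousOn.sub
      (hκ.kernel.continuousOn_volterraConv ((h.measurable.const_mul a).add h.measurable_source) ?_)
    intro T
    obtain ⟨B, hB⟩ := h.bounded T
    obtain ⟨B', hB'⟩ := h.bounded_source T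
    refine ⟨|a| * B + B', fun r h1 h2 => (abs_add_le _ _).trans (add_le_add ?_ (hB' r h1.le h2.le))⟩
    rw [abs_mul]
    exact mul_le_mul_of_nonneg_left (hB r h1.le h2.le) (abs_nonneg a)
  exact h1.congr fun t ht => h.equation t ht

/-- One time lag: the past of the solution is averaged against the balayage measure. -/
theorem step (hκ : IsBalayageKernel κ g b) (h : IsVolterraSolution κ g a f c u) (ha : 0 ≤ a)
    {L t F V : ℝ} {ν : Measure ℝ} (hL : 0 < L) (ht : 0 ≤ t) (hν : IsBalayage κ g b L ν)
    (hF : ∀ s, t ≤ s → s ≤ t + L → |f s| ≤ F)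
    (hV : ∀ s, 0 ≤ s → s ≤ t + L → |a * u s + f s| ≤ V) :
    (1 + a * kernelMass κ L) * |u (t + L)| ≤ ∫ y in Set.Iic t, |u (t - y)| ∂ν
      + |c| * (|g (t + L) - ∫ y in Set.Iic t, g (t - y) ∂ν|
        + a * kernelMass κ L * (g t - g (t + L)))
      + 2 * a * kernelMass κ L ^ 2 * V + kernelMass κ L * F := by
  have := hν.finite
  set K := kernelMass κ L with hK
  set v : ℝ → ℝ := fun s => a * u s + f s with hvdef
  have hv : Measurable v := (h.measurable.const_mul a).add h.measurable_source
  have hVo : ∀ s, 0 < s → s < t + L → |v s| ≤ V := fun s h1 h2 => hV s h1.le h2.le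
  have hK0 : 0 ≤ K := hκ.kernel.kernelMass_nonneg L
  have hstep := hν.volterraConv_add hκ.kernel hL.le ht hv hVo
  have hgi : IntegrableOn (fun y => g (t - y)) (Set.Iic t) ν := by
    have hb : ∀ᵐ y ∂(ν.restrict (Set.Iic t)), ‖g (t - y)‖ ≤ max |g 0| |g t| := by
      filter_upwards [ae_restrict_of_ae hν.nonneg, ae_restrict_mem measurableSet_Iic] with y h1 h2
      have h2' : y ≤ t := h2
      exact abs_le_max_abs_abs (hκ.free_antitone (by linarith)) (hκ.free_antitone (by linarith))
        |>.trans_eq (max_comm _ _)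
    exact Integrable.mono' (integrable_const _)
      (hκ.free_continuous.measurable.comp
        (measurable_const.sub measurable_id)).aestronglyMeasurable hb
  have hui : IntegrableOn (fun y => u (t - y)) (Set.Iic t) ν := by
    obtain ⟨B, hB⟩ := h.bounded t
    refine Integrable.mono' (integrable_const B)
      (h.measurable.comp (measurable_const.sub measurable_id)).aestronglyMeasurable ?_
    filter_upwards [ae_restrict_of_ae hν.nonneg, ae_restrict_mem measurableSet_Iic] with y h1 h2
    have h2' : y ≤ t := h2
    exact hB (t - y) (by linarith) (by linarith)
  -- The convolution vanishes at nonpositive times, so only `y ≤ t` counts, and there the equation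
  -- itself expresses it through `u(t - y)`.
  have hsweep : ∫ y, volterraConv κ v (t - y) ∂ν
      = c * (∫ y in Set.Iic t, g (t - y) ∂ν) - ∫ y in Set.Iic t, u (t - y) ∂ν := by
    have h1 : ∫ y, volterraConv κ v (t - y) ∂ν
        = ∫ y in Set.Iic t, volterraConv κ v (t - y) ∂ν := by
      refine (setIntegral_eq_integral_of_forall_compl_eq_zero fun y hy => ?_).symm
      have : t < y := not_le.1 hy
      exact hκ.kernel.volterraConv_of_nonpos (by linarith)
    rw [h1, ← integral_const_mul, ← integral_sub (hgi.const_mul c) hui]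
    refine setIntegral_congr_fun measurableSet_Iic fun y hy => ?_
    have hy' : y ≤ t := hy
    have := h.equation (t - y) (by linarith)
    simp only [this, hvdef]
    ring
  -- Within the window `u` varies by at most a free term plus `2KV`. A second integration over the
  -- window multiplies this by `K`, so the velocity enters only through `K²V`.
  have hosc : ∀ s, t < s → s < t + L →
      |a * (u s - u (t + L)) + f s| ≤ a * (|c| * (g t - g (t + L)) + 2 * K * V) + F := by
    intro s h1 h2
    have hs0 : 0 ≤ s := by linarith
    refine (abs_add_le _ _).trans (add_le_add ?_ (hF s h1.le h2.le))
    rw [abs_mul, abs_of_nonneg ha]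
    refine mul_le_mul_of_nonneg_left ?_ ha
    rw [h.equation s hs0, h.equation (t + L) (by linarith)]
    have e : c * g s - volterraConv κ v s - (c * g (t + L) - volterraConv κ v (t + L))
        = c * (g s - g (t + L)) - (volterraConv κ v s - volterraConv κ v (t + L)) := by ring
    change |c * g s - volterraConv κ v s - (c * g (t + L) - volterraConv κ v (t + L))| ≤ _
    rw [e]
    refine (abs_sub _ _).trans (add_le_add ?_ ?_)
    · rw [abs_mul]
      refine mul_le_mul_of_nonneg_left ?_ (abs_nonneg c)
      have h3 := hκ.free_antitone h2.le
      have h4 := hκ.free_antitone h1.le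
      rw [abs_of_nonneg (by linarith)]
      linarith
    · refine (hκ.kernel.abs_volterraConv_sub_le hv hs0 h2.le hVo).trans ?_
      have hV0 : 0 ≤ V := (abs_nonneg _).trans (hV s hs0 h2.le)
      have : kernelMass κ (t + L - s) ≤ K := hκ.kernel.kernelMass_mono (by linarith)
      exact mul_le_mul_of_nonneg_right (by linarith) hV0
  -- Freezing `u` at the endpoint isolates `aK u(t + L)`, which moves to the left side and produces
  -- the factor `1 + aK`.
  have hrec : ∫ s in Set.Ioi t, κ (t + L - s) * v s
      = a * K * u (t + L) + ∫ s in Set.Ioi t, κ (t + L - s) * (a * (u s - u (t + L)) + f s) := by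
    have hm : Measurable (fun s => a * (u s - u (t + L)) + f s) :=
      ((h.measurable.sub_const _).const_mul a).add h.measurable_source
    have h1 : ∫ s in Set.Ioi t, κ (t + L - s) = K := by
      rw [setIntegral_comp_sub_eq_kernelMass, add_sub_cancel_left]
    rw [← h1, mul_comm a, mul_assoc, ← integral_mul_const,
      ← integral_add ((hκ.kernel.integrableOn_comp_sub _ _).mul_const _)
        (hκ.kernel.integrableOn_mul hm hosc)]
    refine integral_congr_ae (Eventually.of_forall fun s => ?_)
    simp only [hvdef]
    ring
  have hrec' := hκ.kernel.abs_integral_mul_le hosc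
  rw [add_sub_cancel_left, ← hK] at hrec'
  have heq : (1 + a * K) * u (t + L) = ∫ y in Set.Iic t, u (t - y) ∂ν
      + c * (g (t + L) - ∫ y in Set.Iic t, g (t - y) ∂ν)
      - ∫ s in Set.Ioi t, κ (t + L - s) * (a * (u s - u (t + L)) + f s) := by
    have := h.equation (t + L) (by linarith)
    change u (t + L) = c * g (t + L) - volterraConv κ v (t + L) at this
    rw [hstep, hsweep, hrec] at this
    linear_combination this
  have habs : |∫ y in Set.Iic t, u (t - y) ∂ν| ≤ ∫ y in Set.Iic t, |u (t - y)| ∂ν :=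
    abs_integral_le_integral_abs
  have h5 : (1 + a * K) * |u (t + L)| = |(1 + a * K) * u (t + L)| := by
    rw [abs_mul, abs_of_nonneg (by positivity : 0 ≤ 1 + a * K)]
  have h6 : |c * (g (t + L) - ∫ y in Set.Iic t, g (t - y) ∂ν)|
      = |c| * |g (t + L) - ∫ y in Set.Iic t, g (t - y) ∂ν| := abs_mul _ _
  rw [h5, heq]
  refine (abs_sub _ _).trans ((add_le_add ((abs_add_le _ _).trans
    (add_le_add habs h6.le)) hrec').trans (le_of_eq ?_))
  ring

end IsVolterraSolution

theorem tendsto_measureReal_Ioi_atTop (ν : Measure ℝ) [IsFiniteMeasure ν] :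
    Tendsto (fun t => ν.real (Set.Ioi t)) atTop (𝓝 0) := by
  have h1 : Tendsto (fun t => ν.real (Set.Iic t)) atTop (𝓝 (ν.real Set.univ)) :=
    (ENNReal.tendsto_toReal (measure_ne_top ν _)).comp (tendsto_measure_Iic_atTop ν)
  have h2 := (tendsto_const_nhds (x := ν.real Set.univ)).sub h1
  rw [sub_self] at h2
  refine h2.congr fun t => ?_
  rw [← Set.compl_Iic, measureReal_compl measurableSet_Iic]

namespace IsVolterraSolution

variable {κ g f u : ℝ → ℝ} {a b c : ℝ}

/-- A priori bound: up to a constant and a small multiple of the velocity, `(a + b) sup |u|` is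
at most `sup |f|`. -/
theorem exists_abs_le (hκ : IsBalayageKernel κ g b) (h : IsVolterraSolution κ g a f c u)
    (ha : 0 ≤ a) (hb : 0 ≤ b) {L : ℝ} (hL : 0 < L) :
    ∃ C, ∀ T F V, (∀ s, 0 ≤ s → s ≤ T → |f s| ≤ F) →
      (∀ s, 0 ≤ s → s ≤ T → |a * u s + f s| ≤ V) →
      ∀ t, 0 ≤ t → t ≤ T → (a + b) * |u t| ≤ C + F + 2 * a * kernelMass κ L * V := by
  obtain ⟨ν, hν⟩ := hκ.exists_balayage L hL
  have := hν.finite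
  obtain ⟨B, hB⟩ := h.bounded L
  have hK := hκ.mass_pos L hL
  set K := kernelMass κ L with hKdef
  -- The first term covers a maximum of `|u|` attained before time `L`, where no full lag is
  -- available; the second is the free remainder after division by `K`.
  refine ⟨(a + b) * B + |c| * (1 + a * K) / K, fun T F V hF hV t ht htT => ?_⟩
  have hB0 : 0 ≤ B := (abs_nonneg _).trans (hB 0 le_rfl hL.le)
  have hT0 : 0 ≤ T := ht.trans htT
  have hF0 : 0 ≤ F := (abs_nonneg _).trans (hF 0 le_rfl hT0)
  have hV0 : 0 ≤ V := (abs_nonneg _).trans (hV 0 le_rfl hT0)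
  have hC0 : 0 ≤ |c| * (1 + a * K) / K := by positivity
  have hab : 0 ≤ a + b := add_nonneg ha hb
  obtain ⟨t1, ⟨h10, h1T⟩, hmax⟩ := isCompact_Icc.exists_isMaxOn (Set.nonempty_Icc.2 hT0)
    (((h.continuousOn hκ).mono Set.Icc_subset_Ici_self).abs)
  have hmax' : ∀ s, 0 ≤ s → s ≤ T → |u s| ≤ |u t1| := fun s h1 h2 => hmax ⟨h1, h2⟩
  refine (mul_le_mul_of_nonneg_left (hmax' t ht htT) hab).trans ?_
  rcases le_or_gt t1 L with h1L | h1L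
  · have := mul_le_mul_of_nonneg_left (hB t1 h10 h1L) hab
    have : 0 ≤ 2 * a * K * V := by positivity
    linarith
  · have hs := h.step hκ ha hL (t := t1 - L) (F := F) (V := V) (by linarith) hν
      (fun s h1 h2 => hF s (by linarith) (by linarith))
      (fun s h1 h2 => hV s (by linarith) (by linarith))
    rw [sub_add_cancel, ← hKdef] at hs
    have hist : ∫ y in Set.Iic (t1 - L), |u (t1 - L - y)| ∂ν ≤ |u t1| * (1 - b * K) := by
      calc _ ≤ ∫ y in Set.Iic (t1 - L), |u t1| ∂ν := by
            refine integral_mono_of_nonneg (Eventually.of_forall fun _ => abs_nonneg _)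
              (integrable_const _) ?_
            filter_upwards [ae_restrict_of_ae hν.nonneg, ae_restrict_mem measurableSet_Iic]
              with y h1 h2
            have h2' : y ≤ t1 - L := h2
            exact hmax' _ (by linarith) (by linarith)
        _ = |u t1| * ν.real (Set.Iic (t1 - L)) := by simp [mul_comm]
        _ ≤ |u t1| * (1 - b * K) :=
            mul_le_mul_of_nonneg_left ((measureReal_mono (Set.subset_univ _)).trans hν.mass)
              (abs_nonneg _)
    have hrem := hν.remainder_le (t1 - L) (by linarith)
    rw [sub_add_cancel] at hrem
    have hfree := hκ.free_le (t1 - L) t1 (by linarith)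
    have herr := mul_le_mul_of_nonneg_left (add_le_add hrem
      (mul_le_mul_of_nonneg_left hfree (by positivity : 0 ≤ a * K))) (abs_nonneg c)
    -- At the maximum point the history is at most `(1 - bK)|u t1|`; against `(1 + aK)|u t1|` this
    -- leaves `K(a + b)|u t1|`.
    have hmain : K * ((a + b) * |u t1|) ≤ K * (|c| * (1 + a * K) / K + F + 2 * a * K * V) := by
      have e : K * (|c| * (1 + a * K) / K + F + 2 * a * K * V)
          = |c| * (1 + a * K) + K * F + 2 * a * K ^ 2 * V := by
        field_simp
      rw [e]
      linarith
    have := le_of_mul_le_mul_left hmain hK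
    have : 0 ≤ (a + b) * B := by positivity
    linarith

/-- Asymptotic gain: `(a + b) limsup |u| ≤ limsup |f|` for bounded solutions. -/
theorem eventually_abs_le (hκ : IsBalayageKernel κ g b) (h : IsVolterraSolution κ g a f c u)
    (ha : 0 ≤ a) (hb : 0 ≤ b) {B V F U : ℝ} (hB : ∀ s, 0 ≤ s → |u s| ≤ B)
    (hV : ∀ s, 0 ≤ s → |a * u s + f s| ≤ V) (hF : ∀ᶠ s in atTop, |f s| ≤ F)
    (hU : F < (a + b) * U) : ∀ᶠ s in atTop, |u s| ≤ U := by
  -- `sInf S` is `limsup |u|`. If the claim fails then `U ≤ sInf S`, and one lag will produce an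
  -- eventual bound strictly below `sInf S`.
  set S : Set ℝ := {r | ∀ᶠ s in atTop, |u s| ≤ r} with hS
  have hBS : B ∈ S := by
    filter_upwards [eventually_ge_atTop 0] with s hs using hB s hs
  have hS0 : ∀ r ∈ S, 0 ≤ r := fun r hr => by
    obtain ⟨s, hs⟩ := Eventually.exists (show ∀ᶠ s in atTop, |u s| ≤ r from hr)
    exact (abs_nonneg _).trans hs
  have hbdd : BddBelow S := ⟨0, hS0⟩
  by_contra hcon
  have hUS : U ≤ sInf S := by
    by_contra hlt
    obtain ⟨r, hr, hrU⟩ := exists_lt_of_csInf_lt ⟨B, hBS⟩ (not_le.1 hlt)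
    exact hcon (Eventually.mono (show ∀ᶠ s in atTop, |u s| ≤ r from hr)
      fun s hs => hs.trans hrU.le)
  set D := (a + b) * U - F with hD
  have hD0 : 0 < D := by linarith
  have hV0 : 0 ≤ V := (abs_nonneg _).trans (hV 0 le_rfl)
  -- choose the time lag
  obtain ⟨L, hL, hLD⟩ : ∃ L, 0 < L ∧ 2 * a * kernelMass κ L * V < D / 4 := by
    have h1 : Tendsto (fun L => 2 * a * kernelMass κ L * V) (𝓝[>] 0) (𝓝 (2 * a * 0 * V)) :=
      (((hκ.kernel.tendsto_kernelMass.mono_left nhdsWithin_le_nhds).const_mul _).mul_const _)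
    have h2 := h1.eventually (Iio_mem_nhds (show 2 * a * 0 * V < D / 4 by simp; linarith))
    obtain ⟨L, h3, h4⟩ := (h2.and self_mem_nhdsWithin).exists
    exact ⟨L, h4, h3⟩
  obtain ⟨ν, hν⟩ := hκ.exists_balayage L hL
  have := hν.finite
  have hK := hκ.mass_pos L hL
  set K := kernelMass κ L with hKdef
  obtain ⟨r, hr, hrS⟩ := exists_lt_of_csInf_lt ⟨B, hBS⟩
    (show sInf S < sInf S + K * D / 8 by have := mul_pos hK hD0; linarith)
  have hr0 := hS0 r hr
  obtain ⟨T, hT⟩ := eventually_atTop.1 (show ∀ᶠ s in atTop, |u s| ≤ r from hr)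
  obtain ⟨T', hT'⟩ := eventually_atTop.1 hF
  have hB0 : 0 ≤ B := (abs_nonneg _).trans (hB 0 le_rfl)
  -- History older than `T` is controlled only by the crude bound `B`, but its `ν`-weight is a tail
  -- of a finite measure.
  have hsmall : ∀ᶠ t in atTop, B * ν.real (Set.Ioi (t - max T 0))
      + |c| * (|g (t + L) - ∫ y in Set.Iic t, g (t - y) ∂ν|
        + a * K * (g t - g (t + L))) < K * D / 8 := by
    have h1 : Tendsto (fun t => ν.real (Set.Ioi (t - max T 0))) atTop (𝓝 0) :=
      (tendsto_measureReal_Ioi_atTop ν).comp (tendsto_atTop_add_const_right _ _ tendsto_id)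
    have h2 := (h1.const_mul B).add
      ((hν.remainder_tendsto.add ((hκ.free_tendsto L).const_mul (a * K))).const_mul |c|)
    refine h2.eventually (Iio_mem_nhds ?_)
    have := mul_pos hK hD0
    simp only [mul_zero, add_zero]
    linarith
  -- Error budget: `KD/8` from `r`, `KD/8` from the old history and the free terms, `KD/4` from the
  -- lag. Together they use half of the gap `KD`; the other half lowers the bound.
  have hnew : ∀ᶠ t in atTop, |u (t + L)| ≤ sInf S - K * D / (2 * (1 + a * K)) := by
    filter_upwards [hsmall, eventually_ge_atTop (max T 0), eventually_ge_atTop T'] with t h1 h2 h3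
    have ht0 : 0 ≤ t := (le_max_right _ _).trans h2
    have hs := h.step hκ ha hL (t := t) (F := F) (V := V) ht0 hν
      (fun s h4 _ => hT' s (h3.trans h4)) (fun s h4 _ => hV s h4)
    rw [← hKdef] at hs
    have hist : ∫ y in Set.Iic t, |u (t - y)| ∂ν
        ≤ r * (1 - b * K) + B * ν.real (Set.Ioi (t - max T 0)) := by
      have hind : Integrable (fun y => r + (Set.Ioi (t - max T 0)).indicator (fun _ => B) y)
          ν := (integrable_const _).add ((integrable_const _).indicator measurableSet_Ioi)
      have hnn : ∀ y, 0 ≤ r + (Set.Ioi (t - max T 0)).indicator (fun _ => B) y := fun y =>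
        add_nonneg hr0 (Set.indicator_nonneg (fun _ _ => hB0) y)
      calc _ ≤ ∫ y in Set.Iic t, (r + (Set.Ioi (t - max T 0)).indicator (fun _ => B) y) ∂ν := by
            refine integral_mono_of_nonneg (Eventually.of_forall fun _ => abs_nonneg _)
              hind.integrableOn ?_
            filter_upwards [ae_restrict_of_ae hν.nonneg, ae_restrict_mem measurableSet_Iic]
              with y h4 h5
            have h5' : y ≤ t := h5
            by_cases hy : t - max T 0 < y
            · have hy' : y ∈ Set.Ioi (t - max T 0) := hy
              simp only [Set.indicator_of_mem hy']
              have := hB (t - y) (by linarith)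
              linarith
            · have hy' : y ∉ Set.Ioi (t - max T 0) := hy
              simp only [Set.indicator_of_notMem hy', add_zero]
              refine hT _ ?_
              have := le_max_left T 0
              linarith
        _ ≤ ∫ y, (r + (Set.Ioi (t - max T 0)).indicator (fun _ => B) y) ∂ν :=
            setIntegral_le_integral hind (Eventually.of_forall hnn)
        _ = r * ν.real Set.univ + B * ν.real (Set.Ioi (t - max T 0)) := by
            rw [integral_add (integrable_const _)
              ((integrable_const _).indicator measurableSet_Ioi),
              integral_indicator_const _ measurableSet_Ioi]
            simp [mul_comm]
        _ ≤ _ := by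
            have := mul_le_mul_of_nonneg_left hν.mass hr0
            linarith
    have hpos : 0 < 1 + a * K := by positivity
    have e1 : K * D / (2 * (1 + a * K)) * (1 + a * K) = K * D / 2 := by
      field_simp
    rw [← mul_le_mul_iff_right₀ hpos]
    have e2 : K * D = (a + b) * K * U - K * F := by rw [hD]; ring
    have e3 : 2 * a * K ^ 2 * V ≤ K * D / 4 := by
      have := mul_le_mul_of_nonneg_left hLD.le hK.le
      linarith
    have e4 : (a + b) * K * U ≤ (a + b) * K * sInf S :=
      mul_le_mul_of_nonneg_left hUS (by positivity)
    have e5 : r * (1 - b * K) ≤ (sInf S + K * D / 8) - b * K * sInf S := by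
      have : b * K * sInf S ≤ b * K * r :=
        mul_le_mul_of_nonneg_left (csInf_le hbdd hr) (by positivity)
      linarith
    have e6 : (1 + a * K) * (sInf S - K * D / (2 * (1 + a * K)))
        = (1 + a * K) * sInf S - K * D / 2 := by
      rw [← e1]; ring
    rw [e6]
    linarith
  have hmem : sInf S - K * D / (2 * (1 + a * K)) ∈ S := by
    have h1 := (tendsto_atTop_add_const_right atTop (-L) tendsto_id).eventually hnew
    refine Eventually.mono h1 fun s hs => ?_
    simpa using hs
  have h2 := csInf_le hbdd hmem
  have : 0 < K * D / (2 * (1 + a * K)) := by positivity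
  linarith

end IsVolterraSolution

/-! ### Coupled equations: small gain -/

/-- Small-gain theorem for two coupled Volterra equations. -/
theorem tendsto_zero_of_smallGain {κ₁ κ₂ g₁ g₂ u₁ u₂ : ℝ → ℝ} {a b₁ b₂ c₁ c₂ p q : ℝ}
    (hκ₁ : IsBalayageKernel κ₁ g₁ b₁) (hκ₂ : IsBalayageKernel κ₂ g₂ b₂)
    (ha : 0 ≤ a) (hb₁ : 0 ≤ b₁) (hb₂ : 0 ≤ b₂) (hp : 0 ≤ p) (hq : 0 ≤ q)
    (hpa : p < a + b₁) (hqa : q < a + b₂)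
    (h₁ : IsVolterraSolution κ₁ g₁ a (fun s => p * u₂ s) c₁ u₁)
    (h₂ : IsVolterraSolution κ₂ g₂ a (fun s => q * u₁ s) c₂ u₂) :
    Tendsto u₁ atTop (𝓝 0) ∧ Tendsto u₂ atTop (𝓝 0) := by
  -- boundedness
  obtain ⟨N, hN⟩ : ∃ N, ∀ t, 0 ≤ t → |u₁ t| ≤ N ∧ |u₂ t| ≤ N := by
    -- The velocity is at most `(a + r)M`, with `M` the common maximum of both components. A short
    -- lag lets its error absorb only half of the gap `a + b - r`, so `M` is bounded by a constant
    -- independent of time.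
    have hlag : ∀ (κ g : ℝ → ℝ) (b d r : ℝ), IsBalayageKernel κ g b → 0 < d →
        ∃ L, 0 < L ∧ 2 * a * kernelMass κ L * (a + r) < d := by
      intro κ g b d r hκ hd
      have h1 : Tendsto (fun L => 2 * a * kernelMass κ L * (a + r)) (𝓝[>] 0)
          (𝓝 (2 * a * 0 * (a + r))) :=
        (((hκ.kernel.tendsto_kernelMass.mono_left nhdsWithin_le_nhds).const_mul _).mul_const _)
      have h2 := h1.eventually (Iio_mem_nhds (show 2 * a * 0 * (a + r) < d by simpa using hd))
      obtain ⟨L, h3, h4⟩ := (h2.and self_mem_nhdsWithin).exists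
      exact ⟨L, h4, h3⟩
    obtain ⟨L₁, hL₁, hd₁⟩ := hlag κ₁ g₁ b₁ ((a + b₁ - p) / 2) p hκ₁ (by linarith)
    obtain ⟨L₂, hL₂, hd₂⟩ := hlag κ₂ g₂ b₂ ((a + b₂ - q) / 2) q hκ₂ (by linarith)
    obtain ⟨C₁, hC₁⟩ := h₁.exists_abs_le hκ₁ ha hb₁ hL₁
    obtain ⟨C₂, hC₂⟩ := h₂.exists_abs_le hκ₂ ha hb₂ hL₂
    refine ⟨max (C₁ / ((a + b₁ - p) / 2)) (C₂ / ((a + b₂ - q) / 2)), fun t ht => ?_⟩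
    have hcont : ContinuousOn (fun t => max |u₁ t| |u₂ t|) (Set.Icc 0 t) :=
      (((h₁.continuousOn hκ₁).mono Set.Icc_subset_Ici_self).abs).sup
        (((h₂.continuousOn hκ₂).mono Set.Icc_subset_Ici_self).abs)
    obtain ⟨s, ⟨hs0, hst⟩, hmax⟩ := isCompact_Icc.exists_isMaxOn (Set.nonempty_Icc.2 ht) hcont
    set M := max |u₁ s| |u₂ s| with hM
    have hle : ∀ r, 0 ≤ r → r ≤ t → |u₁ r| ≤ M ∧ |u₂ r| ≤ M := fun r h1 h2 =>
      max_le_iff.1 (show max |u₁ r| |u₂ r| ≤ M from hmax ⟨h1, h2⟩)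
    have hM0 : 0 ≤ M := (abs_nonneg _).trans (le_max_left _ _)
    have hlin : ∀ (d : ℝ) (v w : ℝ), 0 ≤ d → |v| ≤ M → |w| ≤ M →
        |d * w| ≤ d * M ∧ |a * v + d * w| ≤ (a + d) * M := by
      intro d v w hd hv hw
      have h1 : |d * w| ≤ d * M := by
        rw [abs_mul, abs_of_nonneg hd]; exact mul_le_mul_of_nonneg_left hw hd
      have h2 : |a * v| ≤ a * M := by
        rw [abs_mul, abs_of_nonneg ha]; exact mul_le_mul_of_nonneg_left hv ha
      exact ⟨h1, (abs_add_le _ _).trans (by linarith)⟩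
    have e₁ := hC₁ t (p * M) ((a + p) * M)
      (fun r h1 h2 => (hlin p _ _ hp (hle r h1 h2).1 (hle r h1 h2).2).1)
      (fun r h1 h2 => (hlin p _ _ hp (hle r h1 h2).1 (hle r h1 h2).2).2) s hs0 hst
    have e₂ := hC₂ t (q * M) ((a + q) * M)
      (fun r h1 h2 => (hlin q _ _ hq (hle r h1 h2).2 (hle r h1 h2).1).1)
      (fun r h1 h2 => (hlin q _ _ hq (hle r h1 h2).2 (hle r h1 h2).1).2) s hs0 hst
    have hd₁' := mul_le_mul_of_nonneg_right hd₁.le hM0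
    have hd₂' := mul_le_mul_of_nonneg_right hd₂.le hM0
    have hbound : M ≤ max (C₁ / ((a + b₁ - p) / 2)) (C₂ / ((a + b₂ - q) / 2)) := by
      rcases max_choice |u₁ s| |u₂ s| with hc | hc
      · refine le_max_of_le_left ((le_div_iff₀ (by linarith)).2 ?_)
        rw [← hc, ← hM] at e₁
        linarith
      · refine le_max_of_le_right ((le_div_iff₀ (by linarith)).2 ?_)
        rw [← hc, ← hM] at e₂
        linarith
    exact ⟨(hle t ht le_rfl).1.trans hbound, (hle t ht le_rfl).2.trans hbound⟩
  have hN0 : 0 ≤ N := (abs_nonneg _).trans (hN 0 le_rfl).1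
  -- contraction of the asymptotic bounds
  obtain ⟨ρ, hρl, hρ1⟩ : ∃ ρ, max (p / (a + b₁)) (q / (a + b₂)) < ρ ∧ ρ < 1 :=
    exists_between (max_lt ((div_lt_one (by linarith)).2 hpa) ((div_lt_one (by linarith)).2 hqa))
  have hρ₁ : p < (a + b₁) * ρ := by
    have := (div_lt_iff₀ (by linarith)).1 ((le_max_left _ _).trans_lt hρl)
    linarith
  have hρ₂ : q < (a + b₂) * ρ := by
    have := (div_lt_iff₀ (by linarith)).1 ((le_max_right _ _).trans_lt hρl)
    linarith
  have hρ0 : 0 < ρ := (show 0 ≤ p / (a + b₁) from div_nonneg hp (by linarith)).trans_lt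
    ((le_max_left _ _).trans_lt hρl)
  have hmul : ∀ d w r : ℝ, 0 ≤ d → |w| ≤ r → |d * w| ≤ d * r := fun d w r hd hw => by
    rw [abs_mul, abs_of_nonneg hd]; exact mul_le_mul_of_nonneg_left hw hd
  have hcontr : ∀ r, 0 < r → (∀ᶠ t in atTop, |u₁ t| ≤ r ∧ |u₂ t| ≤ r) →
      ∀ᶠ t in atTop, |u₁ t| ≤ ρ * r ∧ |u₂ t| ≤ ρ * r := by
    intro r hr hev
    refine (h₁.eventually_abs_le hκ₁ ha hb₁ (fun s hs => (hN s hs).1) (V := a * N + p * N)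
      (fun s hs => (abs_add_le _ _).trans (add_le_add (hmul _ _ _ ha (hN s hs).1)
        (hmul _ _ _ hp (hN s hs).2))) (F := p * r)
      (hev.mono fun s hs => hmul _ _ _ hp hs.2) ?_).and
      (h₂.eventually_abs_le hκ₂ ha hb₂ (fun s hs => (hN s hs).2) (V := a * N + q * N)
      (fun s hs => (abs_add_le _ _).trans (add_le_add (hmul _ _ _ ha (hN s hs).2)
        (hmul _ _ _ hq (hN s hs).1))) (F := q * r)
      (hev.mono fun s hs => hmul _ _ _ hq hs.1) ?_)
    · rw [← mul_assoc]; exact mul_lt_mul_of_pos_right hρ₁ hr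
    · rw [← mul_assoc]; exact mul_lt_mul_of_pos_right hρ₂ hr
  have hpow : ∀ n : ℕ, ∀ᶠ t in atTop, |u₁ t| ≤ ρ ^ n * (N + 1) ∧ |u₂ t| ≤ ρ ^ n * (N + 1) := by
    intro n
    induction n with
    | zero =>
      filter_upwards [eventually_ge_atTop 0] with t ht
      have := hN t ht
      constructor <;> linarith
    | succ n ih =>
      have := hcontr _ (by positivity) ih
      refine this.mono fun t ht => ?_
      rw [pow_succ', mul_assoc]
      exact ht
  have hlim : Tendsto (fun n : ℕ => ρ ^ n * (N + 1)) atTop (𝓝 0) := by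
    simpa using (tendsto_pow_atTop_nhds_zero_of_lt_one hρ0.le hρ1).mul_const (N + 1)
  constructor <;>
  · rw [Metric.tendsto_nhds]
    intro e he
    obtain ⟨n, hn⟩ := (hlim.eventually (Iio_mem_nhds he)).exists
    refine (hpow n).mono fun t ht => ?_
    rw [Real.dist_eq, sub_zero]
    first
      | exact ht.1.trans_lt hn
      | exact ht.2.trans_lt hn

/-! ### Riemann–Liouville kernels and their balayage measures -/

/-- The Riemann–Liouville kernel `t^(α-1)/Γ(α)`, extended by zero to `t ≤ 0`. -/
noncomputable def rlKernel (α x : ℝ) : ℝ := if 0 < x then x ^ (α - 1) / Real.Gamma α else 0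

/-- The tempered Riemann–Liouville kernel `exp(-r t) t^(α-1)/Γ(α)`. -/
noncomputable def temperedKernel (α r x : ℝ) : ℝ := Real.exp (-r * x) * rlKernel α x

theorem rlKernel_of_pos {α x : ℝ} (hx : 0 < x) : rlKernel α x = x ^ (α - 1) / Real.Gamma α :=
  if_pos hx

theorem rlKernel_of_nonpos {α x : ℝ} (hx : x ≤ 0) : rlKernel α x = 0 := if_neg (not_lt.2 hx)

theorem rlKernel_nonneg {α : ℝ} (hα : 0 < α) (x : ℝ) : 0 ≤ rlKernel α x := by
  unfold rlKernel
  split_ifs with h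
  · exact div_nonneg (Real.rpow_nonneg h.le _) (Real.Gamma_pos_of_pos hα).le
  · exact le_rfl

theorem measurable_rlKernel (α : ℝ) : Measurable (rlKernel α) :=
  Measurable.ite measurableSet_Ioi ((measurable_id.pow_const _).div_const _) measurable_const

theorem integrableOn_rlKernel {α : ℝ} (hα : 0 < α) (L : ℝ) :
    IntegrableOn (rlKernel α) (Set.Iio L) := by
  have h1 : IntegrableOn (rlKernel α) (Set.Ioc 0 (max L 0)) := by
    have : IntegrableOn (fun x : ℝ => x ^ (α - 1) / Real.Gamma α) (Set.Ioc 0 (max L 0)) :=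
      (intervalIntegral.intervalIntegrable_rpow' (a := 0) (b := max L 0)
        (show -1 < α - 1 by linarith)).1.div_const (Real.Gamma α)
    refine this.congr_fun (fun x hx => ?_) measurableSet_Ioc
    exact (rlKernel_of_pos hx.1).symm
  have h2 : IntegrableOn (rlKernel α) (Set.Iic 0) :=
    IntegrableOn.congr_fun (f := fun _ => (0 : ℝ)) integrableOn_zero (fun x hx => (rlKernel_of_nonpos hx).symm)
      measurableSet_Iic
  refine (h2.union h1).mono_set fun x hx => ?_
  have hx' : x < L := hx
  rcases le_or_gt x 0 with h | h
  · exact Or.inl h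
  · exact Or.inr ⟨h, hx'.le.trans (le_max_left _ _)⟩

theorem antitoneOn_rlKernel {α : ℝ} (hα : 0 < α) (hα1 : α ≤ 1) :
    AntitoneOn (rlKernel α) (Set.Ioi 0) := by
  intro x hx y hy hxy
  rw [rlKernel_of_pos hx, rlKernel_of_pos hy]
  exact div_le_div_of_nonneg_right
    (Real.rpow_le_rpow_of_nonpos hx hxy (by linarith)) (Real.Gamma_pos_of_pos hα).le

theorem isVolterraKernel_temperedKernel {α r : ℝ} (hα : 0 < α) (hα1 : α ≤ 1) (hr : 0 ≤ r) :
    IsVolterraKernel (temperedKernel α r) where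
  measurable := (Real.measurable_exp.comp (measurable_const.mul measurable_id)).mul
    (measurable_rlKernel α)
  nonneg x := mul_nonneg (Real.exp_pos _).le (rlKernel_nonneg hα x)
  eq_zero x hx := by rw [temperedKernel, rlKernel_of_nonpos hx, mul_zero]
  antitone := by
    intro x hx y hy hxy
    refine mul_le_mul (Real.exp_le_exp.2 ?_) (antitoneOn_rlKernel hα hα1 hx hy hxy)
      (rlKernel_nonneg hα y) (Real.exp_pos _).le
    nlinarith
  integrable L := by
    refine Integrable.mono' (integrableOn_rlKernel hα L)
      ((Real.measurable_exp.comp (measurable_const.mul measurable_id)).mul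
        (measurable_rlKernel α)).aestronglyMeasurable (Eventually.of_forall fun x => ?_)
    rw [temperedKernel, norm_mul, Real.norm_of_nonneg (Real.exp_pos _).le,
      Real.norm_of_nonneg (rlKernel_nonneg hα x)]
    rcases le_or_gt x 0 with h | h
    · simp [rlKernel_of_nonpos h]
    · exact mul_le_of_le_one_left (rlKernel_nonneg hα x) (Real.exp_le_one_iff.2 (by nlinarith))

theorem temperedKernel_pos {α r x : ℝ} (hα : 0 < α) (hx : 0 < x) : 0 < temperedKernel α r x := by
  rw [temperedKernel, rlKernel_of_pos hx]
  exact mul_pos (Real.exp_pos _) (div_pos (Real.rpow_pos_of_pos hx _) (Real.Gamma_pos_of_pos hα))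

theorem kernelMass_temperedKernel_pos {α r L : ℝ} (hα : 0 < α) (hα1 : α ≤ 1) (hr : 0 ≤ r)
    (hL : 0 < L) : 0 < kernelMass (temperedKernel α r) L := by
  have hk := isVolterraKernel_temperedKernel hα hα1 hr
  unfold kernelMass
  rw [setIntegral_pos_iff_support_of_nonneg_ae (Eventually.of_forall hk.nonneg) (hk.integrable L)]
  refine lt_of_lt_of_le ?_ (measure_mono (s := Set.Ioo 0 L) fun x hx =>
    ⟨(temperedKernel_pos hα hx.1).ne', hx.2⟩)
  simp [hL]

/-- Every kernel value beyond the lag `L` is swept to earlier times by a probability measure. -/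
structure IsSweep (k : ℝ → ℝ) (L : ℝ) (π : Measure ℝ) : Prop where
  prob : IsProbabilityMeasure π
  nonneg : ∀ᵐ y ∂π, 0 ≤ y
  kernel : ∀ x, 0 < x → k (L + x) = ∫ y, k (x - y) ∂π

theorem integrableOn_rpow_neg_div {α A B : ℝ} (hα : 0 < α) (hα1 : α < 1) (hA : 0 < A)
    (hB : 0 < B) : IntegrableOn (fun w : ℝ => w ^ (-α) / (A * w + B)) (Set.Ioi 0) := by
  have hm : Measurable (fun w : ℝ => w ^ (-α) / (A * w + B)) := by fun_prop
  rw [← Set.Ioc_union_Ioi_eq_Ioi (zero_le_one' ℝ)]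
  refine IntegrableOn.union ?_ ?_
  · refine Integrable.mono' ((intervalIntegral.intervalIntegrable_rpow' (a := 0) (b := 1)
      (show -1 < -α by linarith)).1.div_const B) hm.aestronglyMeasurable ?_
    refine (ae_restrict_iff' measurableSet_Ioc).2 (Eventually.of_forall fun w hw => ?_)
    have h0 : 0 < w := hw.1
    have h1 := Real.rpow_pos_of_pos h0 (-α)
    rw [Real.norm_of_nonneg (by positivity)]
    exact div_le_div_of_nonneg_left h1.le hB (by nlinarith)
  · refine Integrable.mono' ((integrableOn_Ioi_rpow_of_lt (show -α - 1 < -1 by linarith)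
      one_pos).div_const A) hm.aestronglyMeasurable ?_
    refine (ae_restrict_iff' measurableSet_Ioi).2 (Eventually.of_forall fun w hw => ?_)
    have h0 : 0 < w := one_pos.trans hw
    have h1 := Real.rpow_pos_of_pos h0 (-α)
    rw [Real.norm_of_nonneg (by positivity), Real.rpow_sub_one h0.ne', div_div]
    exact div_le_div_of_nonneg_left h1.le (by positivity) (by nlinarith)

/-- The scaling `w ↦ (A/B)w` removes both parameters. The remaining integral need not be evaluated:
it serves as a normalizing constant and cancels. -/
theorem integral_rpow_neg_div {α A B : ℝ} (hA : 0 < A) (hB : 0 < B) :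
    ∫ w in Set.Ioi (0 : ℝ), w ^ (-α) / (A * w + B)
      = A ^ (α - 1) * B ^ (-α) * ∫ w in Set.Ioi (0 : ℝ), w ^ (-α) / (1 * w + 1) := by
  have hc : 0 < A / B := div_pos hA hB
  have h := integral_comp_mul_left_Ioi (fun w : ℝ => w ^ (-α) / (1 * w + 1)) 0 hc
  rw [mul_zero, smul_eq_mul] at h
  have e : ∀ w ∈ Set.Ioi (0 : ℝ), (A / B * w) ^ (-α) / (1 * (A / B * w) + 1)
      = (A / B) ^ (-α) * B * (w ^ (-α) / (A * w + B)) := by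
    intro w hw
    have hw : 0 < w := hw
    rw [Real.mul_rpow hc.le hw.le]
    field_simp
  rw [setIntegral_congr_fun measurableSet_Ioi e, integral_const_mul] at h
  have hA' := Real.rpow_pos_of_pos hA α
  have hB' := Real.rpow_pos_of_pos hB α
  rw [Real.div_rpow hA.le hB.le, Real.rpow_neg hA.le, Real.rpow_neg hB.le] at h
  rw [Real.rpow_neg hB.le, Real.rpow_sub_one hA.ne']
  field_simp at h ⊢
  linarith

theorem integral_rpow_neg_div_pos {α : ℝ} (hα : 0 < α) (hα1 : α < 1) :
    0 < ∫ w in Set.Ioi (0 : ℝ), w ^ (-α) / (1 * w + 1) := by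
  have hi := integrableOn_rpow_neg_div hα hα1 one_pos one_pos
  have hpos : ∀ w ∈ Set.Ioi (0 : ℝ), 0 < w ^ (-α) / (1 * w + 1) := fun w hw => by
    have hw : 0 < w := hw
    have := Real.rpow_pos_of_pos hw (-α)
    positivity
  rw [setIntegral_pos_iff_support_of_nonneg_ae ((ae_restrict_iff' measurableSet_Ioi).2
    (Eventually.of_forall fun w hw => (hpos w hw).le)) hi]
  refine lt_of_lt_of_le ?_ (measure_mono (s := Set.Ioi 0) fun x hx => ⟨(hpos x hx).ne', hx⟩)
  simp

/-- Substitution `y = xw/(1 + w)`, a bijection of `(0, ∞)` onto `(0, x)`. It brings the convolution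
of the sweep density with the kernel to the form of the normalization integral. -/
theorem integral_rpow_neg_div_mul_rpow {α L x : ℝ} (hL : 0 < L) (hx : 0 < x) :
    ∫ y in Set.Ioo 0 x, y ^ (-α) / (1 * y + L) * (x - y) ^ (α - 1)
      = ∫ w in Set.Ioi (0 : ℝ), w ^ (-α) / ((x + L) * w + L) := by
  have himg : (fun w : ℝ => x * w / (1 + w)) '' Set.Ioi 0 = Set.Ioo 0 x := by
    ext y
    constructor
    · rintro ⟨w, hw, rfl⟩
      have hw : 0 < w := hw
      refine ⟨by positivity, ?_⟩
      change x * w / (1 + w) < x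
      rw [div_lt_iff₀ (by positivity)]
      nlinarith
    · rintro ⟨h1, h2⟩
      have h3 : 0 < x - y := by linarith
      refine ⟨y / (x - y), div_pos h1 h3, ?_⟩
      change x * (y / (x - y)) / (1 + y / (x - y)) = y
      have h4 : (x - y) + y ≠ 0 := by simpa using hx.ne'
      field_simp
      ring
  have hder : ∀ w ∈ Set.Ioi (0 : ℝ), HasDerivWithinAt (fun w : ℝ => x * w / (1 + w))
      (x / (1 + w) ^ 2) (Set.Ioi 0) w := by
    intro w hw
    have hw : 0 < w := hw
    have h := ((hasDerivAt_id w).const_mul x).div ((hasDerivAt_id w).const_add 1)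
      (by simp only [id]; positivity)
    refine (h.congr_deriv ?_).hasDerivWithinAt
    simp only [id]
    congr 1
    ring
  have hinj : Set.InjOn (fun w : ℝ => x * w / (1 + w)) (Set.Ioi 0) := by
    intro v hv w hw h
    have hv : 0 < v := hv
    have hw : 0 < w := hw
    have h : x * v / (1 + v) = x * w / (1 + w) := h
    rw [div_eq_div_iff (by positivity) (by positivity)] at h
    have : x * (v - w) = 0 := by linarith
    rcases mul_eq_zero.1 this with h | h <;> linarith
  rw [← himg, integral_image_eq_integral_abs_deriv_smul measurableSet_Ioi hder hinj]
  refine setIntegral_congr_fun measurableSet_Ioi fun w hw => ?_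
  have hw : 0 < w := hw
  have h1 : 0 < 1 + w := by positivity
  have e : x - x * w / (1 + w) = x / (1 + w) := by field_simp; ring
  change |x / (1 + w) ^ 2| • ((x * w / (1 + w)) ^ (-α) / (1 * (x * w / (1 + w)) + L)
    * (x - x * w / (1 + w)) ^ (α - 1)) = _
  rw [e, abs_of_pos (by positivity), smul_eq_mul, Real.div_rpow (by positivity) h1.le,
    Real.mul_rpow hx.le hw.le, Real.div_rpow hx.le h1.le, Real.rpow_sub_one hx.ne',
    Real.rpow_sub_one h1.ne', Real.rpow_neg hx.le, Real.rpow_neg h1.le]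
  have hxa := Real.rpow_pos_of_pos hx α
  have h1a := Real.rpow_pos_of_pos h1 α
  have e2 : 1 * (x * w / (1 + w)) + L = ((x + L) * w + L) / (1 + w) := by field_simp; ring
  rw [e2]
  have h3 : 0 < (x + L) * w + L := by positivity
  field_simp

/-- For `α < 1` the measure has density `C⁻¹ L^α y^(-α)/(y + L)` on `(0, ∞)`. Its mass and its
convolution with the kernel are the same integral with `A = 1` and `A = x + L`, so `C` cancels and
`(x + L)^(α-1)` remains. For `α = 1` the kernel is constant on `(0, ∞)` and a point mass at `0`
suffices. -/
theorem exists_isSweep_rlKernel {α L : ℝ} (hα : 0 < α) (hα1 : α ≤ 1) (hL : 0 < L) :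
    ∃ π, IsSweep (rlKernel α) L π := by
  rcases eq_or_lt_of_le hα1 with rfl | hα1
  · refine ⟨Measure.dirac 0, inferInstance, by simp, fun x hx => ?_⟩
    rw [integral_dirac, sub_zero, rlKernel_of_pos hx, rlKernel_of_pos (by positivity)]
    simp
  set C := ∫ w in Set.Ioi (0 : ℝ), w ^ (-α) / (1 * w + 1) with hC
  have hC0 : 0 < C := integral_rpow_neg_div_pos hα hα1
  set p : ℝ → ℝ := fun y => C⁻¹ * L ^ α * (y ^ (-α) / (1 * y + L)) with hp
  have hLa := Real.rpow_pos_of_pos hL α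
  have hpm : Measurable p := by
    rw [hp]; fun_prop
  have hp0 : ∀ y ∈ Set.Ioi (0 : ℝ), 0 ≤ p y := fun y hy => by
    have hy : 0 < y := hy
    have := Real.rpow_pos_of_pos hy (-α)
    simp only [hp]
    positivity
  have hpi : IntegrableOn p (Set.Ioi 0) :=
    (integrableOn_rpow_neg_div hα hα1 one_pos hL).const_mul _
  set π : Measure ℝ := (volume.restrict (Set.Ioi 0)).withDensity fun y => ENNReal.ofReal (p y)
    with hπ
  refine ⟨π, ⟨?_⟩, ?_, fun x hx => ?_⟩
  · rw [hπ, withDensity_apply _ MeasurableSet.univ, Measure.restrict_univ,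
      ← ofReal_integral_eq_lintegral_ofReal hpi
        ((ae_restrict_iff' measurableSet_Ioi).2 (Eventually.of_forall hp0)), hp,
      integral_const_mul, integral_rpow_neg_div one_pos hL, ← hC, Real.one_rpow,
      Real.rpow_neg hL.le, ENNReal.ofReal_eq_one]
    field_simp
  · refine (withDensity_absolutelyContinuous _ _).ae_le ?_
    filter_upwards [ae_restrict_mem measurableSet_Ioi] with y hy using le_of_lt hy
  · rw [hπ, integral_withDensity_eq_integral_toReal_smul (by fun_prop)
      (Eventually.of_forall fun _ => ENNReal.ofReal_lt_top)]
    have h1 : ∫ y in Set.Ioi (0 : ℝ), (ENNReal.ofReal (p y)).toReal • rlKernel α (x - y)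
        = ∫ y in Set.Ioo 0 x, C⁻¹ * L ^ α / Real.Gamma α
          * (y ^ (-α) / (1 * y + L) * (x - y) ^ (α - 1)) := by
      rw [setIntegral_eq_of_subset_of_forall_sdiff_eq_zero measurableSet_Ioi
        (s := Set.Ioo 0 x) Set.Ioo_subset_Ioi_self]
      · refine setIntegral_congr_fun measurableSet_Ioo fun y hy => ?_
        rw [ENNReal.toReal_ofReal (hp0 y hy.1), rlKernel_of_pos (sub_pos.2 hy.2), hp, smul_eq_mul]
        ring
      · intro y hy
        have : x ≤ y := by
          by_contra h
          exact hy.2 ⟨hy.1, not_le.1 h⟩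
        rw [rlKernel_of_nonpos (by linarith), smul_zero]
    rw [h1, integral_const_mul, integral_rpow_neg_div_mul_rpow hL hx,
      integral_rpow_neg_div (by positivity) hL, ← hC, rlKernel_of_pos (by positivity),
      Real.rpow_neg hL.le, add_comm L x]
    field_simp

/-- A Gamma integral. The total mass `r^(-α)` is the origin of `lam^α` in the threshold. -/
theorem integral_temperedKernel {α r : ℝ} (hα : 0 < α) (hr : 0 < r) :
    Integrable (temperedKernel α r) ∧ ∫ x, temperedKernel α r x = (r ^ α)⁻¹ := by
  have hΓ := Real.Gamma_pos_of_pos hα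
  have e : temperedKernel α r = (Set.Ioi 0).indicator
      (fun x => x ^ (α - 1) * Real.exp (-r * x) / Real.Gamma α) := by
    ext x
    by_cases hx : 0 < x
    · rw [Set.indicator_of_mem (show x ∈ Set.Ioi 0 from hx), temperedKernel, rlKernel_of_pos hx]
      ring
    · rw [Set.indicator_of_notMem (show x ∉ Set.Ioi 0 from hx), temperedKernel,
        rlKernel_of_nonpos (not_lt.1 hx), mul_zero]
  have hint : IntegrableOn (fun x : ℝ => x ^ (α - 1) * Real.exp (-r * x)) (Set.Ioi 0) := by
    have := integrableOn_rpow_mul_exp_neg_mul_rpow (s := α - 1) (p := 1) (by linarith)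
      one_pos hr
    simpa using this
  constructor
  · rw [e, integrable_indicator_iff measurableSet_Ioi]
    exact hint.div_const _
  · rw [e, integral_indicator measurableSet_Ioi, integral_div]
    simp only [neg_mul]
    rw [Real.integral_rpow_mul_exp_neg_mul_Ioi hα hr, one_div, Real.inv_rpow hr.le]
    field_simp

/-- Weighting the untempered sweep by `e^(-r(L+y))` makes the exponentials match. For `r > 0`,
integrating the kernel identity over `x > 0` gives `r^(-α) - K = ν(ℝ) r^(-α)`, which is the mass
bound with equality; for `r = 0` the mass is at most that of a probability measure. -/
theorem exists_isBalayage_temperedKernel {α r L : ℝ} (hα : 0 < α) (hα1 : α ≤ 1) (hr : 0 ≤ r)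
    (hL : 0 < L) :
    ∃ ν, IsBalayage (temperedKernel α r) (fun t => Real.exp (-r * t)) (r ^ α) L ν := by
  obtain ⟨π, hπ⟩ := exists_isSweep_rlKernel hα hα1 hL
  have := hπ.prob
  have hk := isVolterraKernel_temperedKernel hα hα1 hr
  set d : ℝ → ℝ := fun y => Real.exp (-r * (L + y)) with hd
  have hdm : Measurable d := by rw [hd]; fun_prop
  have hd0 : ∀ y, 0 ≤ d y := fun y => (Real.exp_pos _).le
  have hd1 : ∀ᵐ y ∂π, ENNReal.ofReal (d y) ≤ 1 := by
    filter_upwards [hπ.nonneg] with y hy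
    rw [ENNReal.ofReal_le_one]
    exact Real.exp_le_one_iff.2 (by nlinarith)
  set ν : Measure ℝ := π.withDensity fun y => ENNReal.ofReal (d y) with hν
  have hint : ∀ (s : Set ℝ) (φ : ℝ → ℝ), MeasurableSet s →
      ∫ y in s, φ y ∂ν = ∫ y in s, d y * φ y ∂π := by
    intro s φ hs
    rw [hν, setIntegral_withDensity_eq_setIntegral_toReal_smul (by fun_prop)
      (Eventually.of_forall fun _ => ENNReal.ofReal_lt_top) _ hs]
    simp only [ENNReal.toReal_ofReal (hd0 _), smul_eq_mul]
  have hfin : IsFiniteMeasure ν := by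
    refine ⟨?_⟩
    rw [hν, withDensity_apply _ MeasurableSet.univ, Measure.restrict_univ]
    calc _ ≤ ∫⁻ _, 1 ∂π := lintegral_mono_ae hd1
      _ < ⊤ := by simp
  have hnn : ∀ᵐ y ∂ν, 0 ≤ y := (withDensity_absolutelyContinuous _ _).ae_le hπ.nonneg
  have hker : ∀ x, 0 < x → temperedKernel α r (L + x) = ∫ y, temperedKernel α r (x - y) ∂ν := by
    intro x hx
    have h := hint Set.univ (fun y => temperedKernel α r (x - y)) MeasurableSet.univ
    simp only [Measure.restrict_univ] at h
    rw [h, temperedKernel, hπ.kernel x hx, ← integral_const_mul]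
    refine integral_congr_ae (Eventually.of_forall fun y => ?_)
    simp only [hd, temperedKernel]
    rw [← mul_assoc, ← Real.exp_add]
    ring_nf
  -- The weight times `e^(-r(t-y))` does not depend on `y`, so the free evolution fails to be swept
  -- only by the tail of `π` beyond `t`.
  have hrem : ∀ t, Real.exp (-r * (t + L)) - ∫ y in Set.Iic t, Real.exp (-r * (t - y)) ∂ν
      = Real.exp (-r * (t + L)) * π.real (Set.Ioi t) := by
    intro t
    rw [hint _ _ measurableSet_Iic]
    have h1 : ∀ y, d y * Real.exp (-r * (t - y)) = Real.exp (-r * (t + L)) := fun y => by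
      rw [hd, ← Real.exp_add]; ring_nf
    simp only [h1]
    rw [setIntegral_const, smul_eq_mul, ← Set.compl_Iic, measureReal_compl measurableSet_Iic,
      probReal_univ]
    ring
  have hexp : ∀ t, 0 ≤ t → Real.exp (-r * (t + L)) ≤ 1 := fun t ht =>
    Real.exp_le_one_iff.2 (by nlinarith)
  have hremabs : ∀ t, 0 ≤ t → |Real.exp (-r * (t + L))
      - ∫ y in Set.Iic t, Real.exp (-r * (t - y)) ∂ν| ≤ π.real (Set.Ioi t) := by
    intro t ht
    rw [hrem, abs_of_nonneg (mul_nonneg (Real.exp_pos _).le measureReal_nonneg)]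
    exact mul_le_of_le_one_left measureReal_nonneg (hexp t ht)
  refine ⟨ν, hfin, hnn, hker, ?_, fun t ht => (hremabs t ht).trans measureReal_le_one, ?_⟩
  · rcases eq_or_lt_of_le hr with h0 | hr0
    · rw [← h0, Real.zero_rpow hα.ne', zero_mul, sub_zero]
      rw [measureReal_def]
      refine ENNReal.toReal_le_of_le_ofReal zero_le_one ?_
      rw [hν, withDensity_apply _ MeasurableSet.univ, Measure.restrict_univ]
      calc _ ≤ ∫⁻ _, 1 ∂π := lintegral_mono_ae hd1
        _ = ENNReal.ofReal 1 := by simp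
    · obtain ⟨hI, hIv⟩ := integral_temperedKernel hα hr0
      have hra := Real.rpow_pos_of_pos hr0 α
      have hprod : Integrable (fun q : ℝ × ℝ => temperedKernel α r (q.1 - q.2))
          ((volume.restrict (Set.Ioi 0)).prod ν) := by
        have hm : Measurable (fun q : ℝ × ℝ => temperedKernel α r (q.1 - q.2)) :=
          hk.measurable.comp (measurable_fst.sub measurable_snd)
        rw [integrable_prod_iff' hm.aestronglyMeasurable]
        refine ⟨Eventually.of_forall fun y => (hI.comp_sub_right y).integrableOn, ?_⟩
        refine Integrable.mono' (integrable_const ((r ^ α)⁻¹))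
          hm.aestronglyMeasurable.norm.prod_swap.integral_prod_right'
          (Eventually.of_forall fun y => ?_)
        simp only [Real.norm_of_nonneg (hk.nonneg _)]
        rw [Real.norm_of_nonneg (integral_nonneg fun _ => hk.nonneg _), ← hIv,
          ← integral_sub_right_eq_self (temperedKernel α r) y]
        exact setIntegral_le_integral (hI.comp_sub_right y)
          (Eventually.of_forall fun _ => hk.nonneg _)
      have h1 : ∫ x in Set.Ioi (0 : ℝ), temperedKernel α r (L + x)
          = (r ^ α)⁻¹ - kernelMass (temperedKernel α r) L := by
        have h2 : ∫ x in Set.Ioi (0 : ℝ), temperedKernel α r (L + x)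
            = ∫ x in Set.Ici L, temperedKernel α r x := by
          rw [integral_Ici_eq_integral_Ioi, ← integral_indicator measurableSet_Ioi,
            ← integral_indicator measurableSet_Ioi,
            ← integral_add_left_eq_self ((Set.Ioi L).indicator _) L]
          congr 1
          ext x
          simp [Set.indicator]
        rw [h2, ← hIv, kernelMass, ← Set.compl_Iio,
          ← integral_add_compl (measurableSet_Iio (a := L)) hI]
        ring
      have h2 : ∫ x in Set.Ioi (0 : ℝ), temperedKernel α r (L + x)
          = ν.real Set.univ * (r ^ α)⁻¹ := by
        calc _ = ∫ x in Set.Ioi (0 : ℝ), ∫ y, temperedKernel α r (x - y) ∂ν :=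
              setIntegral_congr_fun measurableSet_Ioi fun x hx => hker x hx
          _ = ∫ y, ∫ x in Set.Ioi (0 : ℝ), temperedKernel α r (x - y) ∂volume ∂ν :=
              integral_integral_swap hprod
          _ = ∫ y, (r ^ α)⁻¹ ∂ν := by
              refine integral_congr_ae ?_
              filter_upwards [hnn] with y hy
              rw [← hIv, ← integral_sub_right_eq_self (temperedKernel α r) y]
              refine setIntegral_eq_integral_of_forall_compl_eq_zero fun x hx => ?_
              have hx : x ≤ 0 := not_lt.1 hx
              exact hk.eq_zero _ (by linarith)
          _ = ν.real Set.univ * (r ^ α)⁻¹ := by simp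
      have h3 := h2.symm.trans h1
      refine le_of_eq ?_
      field_simp at h3
      linarith
  · refine squeeze_zero' (Eventually.of_forall fun _ => abs_nonneg _) ?_
      (tendsto_measureReal_Ioi_atTop π)
    filter_upwards [eventually_ge_atTop 0] with t ht using hremabs t ht

theorem isBalayageKernel_temperedKernel {α r : ℝ} (hα : 0 < α) (hα1 : α ≤ 1) (hr : 0 ≤ r) :
    IsBalayageKernel (temperedKernel α r) (fun t => Real.exp (-r * t)) (r ^ α) where
  kernel := isVolterraKernel_temperedKernel hα hα1 hr
  mass_pos L hL := kernelMass_temperedKernel_pos hα hα1 hr hL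
  exists_balayage L hL := exists_isBalayage_temperedKernel hα hα1 hr hL
  free_continuous := by fun_prop
  free_antitone s t hst := Real.exp_le_exp.2 (by nlinarith)
  free_le s t hs := by
    have h1 : Real.exp (-r * s) ≤ 1 := Real.exp_le_one_iff.2 (by nlinarith)
    have h2 := Real.exp_pos (-r * t)
    linarith
  free_tendsto L := by
    rcases eq_or_lt_of_le hr with rfl | hr
    · simp
    · have h1 : Tendsto (fun t : ℝ => Real.exp (-r * t)) atTop (𝓝 0) :=
        Real.tendsto_exp_atBot.comp (tendsto_id.const_mul_atTop_of_neg (neg_lt_zero.2 hr))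
      have h2 := h1.comp (tendsto_atTop_add_const_right atTop L tendsto_id)
      simpa using h1.sub h2

/-! ### From Caputo equations to Volterra equations -/

theorem volterraConv_congr {κ v w : ℝ → ℝ} {t : ℝ} (hκ : ∀ x, x ≤ 0 → κ x = 0)
    (h : ∀ᵐ s ∂volume, 0 < s → s < t → v s = w s) :
    volterraConv κ v t = volterraConv κ w t := by
  refine integral_congr_ae ?_
  filter_upwards [ae_restrict_of_ae h, ae_restrict_mem measurableSet_Ioi] with s hs hs0
  rcases lt_or_ge s t with hst | hst
  · rw [hs hs0 hst]
  · simp [hκ (t - s) (by linarith)]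

theorem volterraConv_eq_intervalIntegral {κ v : ℝ → ℝ} {t : ℝ} (hκ : ∀ x, x ≤ 0 → κ x = 0)
    (ht : 0 ≤ t) : volterraConv κ v t = ∫ s in (0 : ℝ)..t, κ (t - s) * v s := by
  rw [intervalIntegral.integral_of_le ht]
  refine setIntegral_eq_of_subset_of_forall_sdiff_eq_zero measurableSet_Ioi
    Set.Ioc_subset_Ioi_self fun s hs => ?_
  have : t < s := by
    by_contra h
    exact hs.2 ⟨hs.1, not_lt.1 h⟩
  rw [hκ _ (by linarith), zero_mul]

theorem volterraConv_rlKernel_one {v : ℝ → ℝ} {t : ℝ} (ht : 0 ≤ t) :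
    volterraConv (rlKernel 1) v t = ∫ s in (0 : ℝ)..t, v s := by
  rw [volterraConv_eq_intervalIntegral (fun x hx => rlKernel_of_nonpos hx) ht,
    intervalIntegral.integral_of_le ht, intervalIntegral.integral_of_le ht]
  have hne : ∀ᵐ s ∂(volume.restrict (Set.Ioc 0 t)), s ≠ t :=
    ae_restrict_of_ae (by simp [ae_iff, measure_singleton])
  refine integral_congr_ae ?_
  filter_upwards [hne, ae_restrict_mem measurableSet_Ioc] with s h1 h2
  rw [rlKernel_of_pos (sub_pos.2 (lt_of_le_of_ne h2.2 h1))]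
  simp

/-- For `α < 1` the Caputo derivative is the convolution of the derivative with the
Riemann–Liouville kernel of order `1 - α`. -/
theorem caputoDeriv_eq_volterraConv {α t : ℝ} (f : ℝ → ℝ) (hα : α ≠ 1) (ht : 0 ≤ t) :
    caputoDeriv α f t = volterraConv (rlKernel (1 - α)) (deriv f) t := by
  rw [caputoDeriv, if_neg hα,
    volterraConv_eq_intervalIntegral (fun x hx => rlKernel_of_nonpos hx) ht,
    intervalIntegral.integral_of_le ht, intervalIntegral.integral_of_le ht, ← integral_const_mul]
  have hne : ∀ᵐ s ∂(volume.restrict (Set.Ioc 0 t)), s ≠ t :=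
    ae_restrict_of_ae (by simp [ae_iff, measure_singleton])
  refine integral_congr_ae ?_
  filter_upwards [hne, ae_restrict_mem measurableSet_Ioc] with s h1 h2
  rw [rlKernel_of_pos (sub_pos.2 (lt_of_le_of_ne h2.2 h1)), show 1 - α - 1 = -α by ring]
  ring

theorem integral_betaPDFReal {α β : ℝ} (hα : 0 < α) (hβ : 0 < β) :
    Integrable (betaPDFReal α β) ∧ ∫ x, betaPDFReal α β x = 1 := by
  have h0 : ∀ x, 0 ≤ betaPDFReal α β x := fun x => by
    by_cases h : 0 < x ∧ x < 1
    · exact (betaPDFReal_pos h.1 h.2 hα hβ).le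
    · rw [betaPDFReal, if_neg h]
  have h1 : ∫⁻ x, ENNReal.ofReal (betaPDFReal α β x) = 1 := lintegral_betaPDF_eq_one hα hβ
  constructor
  · refine ⟨(measurable_betaPDFReal α β).aestronglyMeasurable, ?_⟩
    rw [hasFiniteIntegral_iff_ofReal (Eventually.of_forall h0), h1]
    exact ENNReal.one_lt_top
  · rw [integral_eq_lintegral_of_nonneg_ae (Eventually.of_forall h0)
      (measurable_betaPDFReal α β).aestronglyMeasurable, h1, ENNReal.toReal_one]

/-- The Riemann–Liouville kernels of orders `α` and `1 - α` convolve to the constant `1`. -/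
theorem integral_rlKernel_mul_rlKernel {α t τ : ℝ} (hα : 0 < α) (hα1 : α < 1) (h : τ < t) :
    Integrable (fun s => rlKernel α (t - s) * rlKernel (1 - α) (s - τ)) ∧
      ∫ s, rlKernel α (t - s) * rlKernel (1 - α) (s - τ) = 1 := by
  have hT : 0 < t - τ := sub_pos.2 h
  obtain ⟨hI, hv⟩ := integral_betaPDFReal hα (sub_pos.2 hα1)
  -- In the variable `(t - s)/(t - τ)` the product is the density of the Beta law with parameters
  -- `α` and `1 - α`, because `Γ(α + (1 - α)) = 1`; its total mass is therefore known.
  have e : (fun s => rlKernel α (t - s) * rlKernel (1 - α) (s - τ))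
      = fun s => (t - τ)⁻¹ * betaPDFReal α (1 - α) ((t - s) / (t - τ)) := by
    ext s
    by_cases hs : 0 < t - s ∧ 0 < s - τ
    · have h1 : 0 < (t - s) / (t - τ) ∧ (t - s) / (t - τ) < 1 :=
        ⟨div_pos hs.1 hT, (div_lt_one hT).2 (by linarith [hs.2])⟩
      have h2 : 1 - (t - s) / (t - τ) = (s - τ) / (t - τ) := by field_simp; ring
      have hΓ1 := Real.Gamma_pos_of_pos hα
      have hΓ2 := Real.Gamma_pos_of_pos (sub_pos.2 hα1)
      have hTa := Real.rpow_pos_of_pos hT α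
      rw [betaPDFReal, if_pos h1, h2, rlKernel_of_pos hs.1, rlKernel_of_pos hs.2, beta,
        add_sub_cancel, Real.Gamma_one, Real.div_rpow hs.1.le hT.le, Real.div_rpow hs.2.le hT.le,
        Real.rpow_sub_one hT.ne' α, show 1 - α - 1 = -α by ring, Real.rpow_neg hT.le]
      field_simp
    · have h1 : ¬ (0 < (t - s) / (t - τ) ∧ (t - s) / (t - τ) < 1) := by
        rintro ⟨h1, h2⟩
        refine hs ⟨(div_pos_iff_of_pos_right hT).1 h1, ?_⟩
        have := (div_lt_one hT).1 h2
        linarith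
      rw [betaPDFReal, if_neg h1, mul_zero]
      rcases not_and_or.1 hs with h2 | h2
      · rw [rlKernel_of_nonpos (not_lt.1 h2), zero_mul]
      · rw [rlKernel_of_nonpos (not_lt.1 h2), mul_zero]
  rw [e]
  constructor
  · exact ((hI.comp_div hT.ne').comp_sub_left t).const_mul _
  · rw [integral_const_mul, integral_sub_left_eq_self
      (fun s => betaPDFReal α (1 - α) (s / (t - τ))) volume t,
      Measure.integral_comp_div, hv, abs_of_pos hT, smul_eq_mul]
    field_simp

/-- The inner integral over `s` of the two kernels is at most `1`, so by Tonelli `|w|` on `(0, t]`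
dominates. This justifies the exchange of integrals below, and also the almost everywhere
convergence of the Caputo integral. -/
theorem integrable_rlKernel_iterated {α t : ℝ} {w : ℝ → ℝ} (hα : 0 < α) (hα1 : α < 1)
    (hw : Measurable w) (hi : IntegrableOn w (Set.Ioc 0 t)) :
    Integrable (fun p : ℝ × ℝ => rlKernel α (t - p.1) * (rlKernel (1 - α) (p.1 - p.2) * w p.2))
      ((volume.restrict (Set.Ioi 0)).prod (volume.restrict (Set.Ioi 0))) := by
  have hm : Measurable (fun p : ℝ × ℝ =>
      rlKernel α (t - p.1) * (rlKernel (1 - α) (p.1 - p.2) * w p.2)) :=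
    ((measurable_rlKernel α).comp (measurable_const.sub measurable_fst)).mul
      (((measurable_rlKernel (1 - α)).comp (measurable_fst.sub measurable_snd)).mul
        (hw.comp measurable_snd))
  have hzero : ∀ s τ, t ≤ τ → rlKernel α (t - s) * rlKernel (1 - α) (s - τ) = 0 := by
    intro s τ hτ
    rcases le_total s τ with h | h
    · rw [rlKernel_of_nonpos (sub_nonpos.2 h), mul_zero]
    · rw [rlKernel_of_nonpos (show t - s ≤ 0 by linarith), zero_mul]
  have hint : ∀ τ, Integrable (fun s => rlKernel α (t - s) * rlKernel (1 - α) (s - τ)) := by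
    intro τ
    rcases lt_or_ge τ t with h | h
    · exact (integral_rlKernel_mul_rlKernel hα hα1 h).1
    · simp only [hzero _ τ h]
      exact integrable_zero _ _ _
  have hnn : ∀ s τ, 0 ≤ rlKernel α (t - s) * rlKernel (1 - α) (s - τ) := fun s τ =>
    mul_nonneg (rlKernel_nonneg hα _) (rlKernel_nonneg (sub_pos.2 hα1) _)
  rw [integrable_prod_iff' hm.aestronglyMeasurable]
  constructor
  · refine Eventually.of_forall fun τ => ?_
    simp only [← mul_assoc]
    exact ((hint τ).mul_const _).integrableOn
  · have hdom : IntegrableOn ((Set.Ioc 0 t).indicator fun τ => |w τ|) (Set.Ioi 0) := by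
      refine Integrable.integrableOn ?_
      rw [integrable_indicator_iff measurableSet_Ioc]
      exact hi.abs
    refine Integrable.mono' hdom hm.aestronglyMeasurable.norm.prod_swap.integral_prod_right' ?_
    filter_upwards [ae_restrict_mem measurableSet_Ioi] with τ hτ
    simp only [← mul_assoc, norm_mul (_ * _) (w _), Real.norm_of_nonneg (hnn _ _)]
    rw [Real.norm_of_nonneg (integral_nonneg fun s => mul_nonneg (hnn _ _) (norm_nonneg _)),
      integral_mul_const]
    rcases lt_or_ge τ t with h | h
    · rw [Set.indicator_of_mem (show τ ∈ Set.Ioc 0 t from ⟨hτ, h.le⟩)]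
      refine mul_le_of_le_one_left (norm_nonneg _) ?_
      exact (setIntegral_le_integral (hint τ) (Eventually.of_forall fun s => hnn _ _)).trans_eq
        (integral_rlKernel_mul_rlKernel hα hα1 h).2
    · simp only [hzero _ τ h]
      simp only [integral_zero, zero_mul]
      exact Set.indicator_nonneg (fun _ _ => abs_nonneg _) _

/-- The semigroup law of fractional integration in the case `α + (1 - α) = 1`; it inverts the Caputo
derivative. -/
theorem volterraConv_rlKernel_rlKernel {α t : ℝ} {w : ℝ → ℝ} (hα : 0 < α) (hα1 : α < 1)
    (hw : Measurable w) (hi : IntegrableOn w (Set.Ioc 0 t)) (ht : 0 ≤ t) :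
    volterraConv (rlKernel α) (volterraConv (rlKernel (1 - α)) w) t = ∫ τ in (0 : ℝ)..t, w τ := by
  have hF := integrable_rlKernel_iterated hα hα1 hw hi
  calc volterraConv (rlKernel α) (volterraConv (rlKernel (1 - α)) w) t
      = ∫ s in Set.Ioi (0 : ℝ), ∫ τ in Set.Ioi (0 : ℝ),
          rlKernel α (t - s) * (rlKernel (1 - α) (s - τ) * w τ) := by
        simp only [volterraConv, integral_const_mul]
    _ = ∫ τ in Set.Ioi (0 : ℝ), ∫ s in Set.Ioi (0 : ℝ),
          rlKernel α (t - s) * (rlKernel (1 - α) (s - τ) * w τ) := integral_integral_swap hF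
    _ = ∫ τ in Set.Ioi (0 : ℝ), rlKernel 1 (t - τ) * w τ := by
        refine setIntegral_congr_fun measurableSet_Ioi fun τ hτ => ?_
        have hτ : 0 < τ := hτ
        simp only [← mul_assoc, integral_mul_const]
        congr 1
        rw [setIntegral_eq_integral_of_forall_compl_eq_zero]
        · rcases lt_or_ge τ t with h | h
          · rw [(integral_rlKernel_mul_rlKernel hα hα1 h).2, rlKernel_of_pos (sub_pos.2 h)]
            simp
          · rw [rlKernel_of_nonpos (sub_nonpos.2 h)]
            refine integral_eq_zero_of_ae (Eventually.of_forall fun s => ?_)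
            rcases le_total s τ with h' | h'
            · simp [rlKernel_of_nonpos (sub_nonpos.2 h')]
            · simp [rlKernel_of_nonpos (show t - s ≤ 0 by linarith)]
        · intro s hs
          have hs : s ≤ 0 := not_lt.1 hs
          rw [rlKernel_of_nonpos (show s - τ ≤ 0 by linarith), mul_zero]
    _ = ∫ τ in (0 : ℝ)..t, w τ := volterraConv_rlKernel_one ht

/-- Local absolute continuity on `[0, ∞)`. -/
def LocallyAC (f : ℝ → ℝ) : Prop := ∀ T, 0 ≤ T → AbsolutelyContinuousOnInterval f 0 T

namespace LocallyAC

variable {f : ℝ → ℝ}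

theorem integrableOn_deriv (hf : LocallyAC f) {t : ℝ} (ht : 0 ≤ t) :
    IntegrableOn (deriv f) (Set.Ioc 0 t) :=
  (intervalIntegrable_iff_integrableOn_Ioc_of_le ht).1 (hf t ht).intervalIntegrable_deriv

theorem continuousOn (hf : LocallyAC f) : ContinuousOn f (Set.Ici 0) := by
  intro t ht
  have ht : 0 ≤ t := ht
  have h := (hf (t + 1) (by linarith)).continuousOn
  rw [Set.uIcc_of_le (by linarith)] at h
  refine (h t ⟨ht, by linarith⟩).mono_of_mem_nhdsWithin ?_
  have : Set.Iio (t + 1) ∈ 𝓝 t := Iio_mem_nhds (by linarith)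
  filter_upwards [self_mem_nhdsWithin, nhdsWithin_le_nhds this] with s h1 h2
  exact ⟨h1, le_of_lt h2⟩

theorem ae_differentiableAt (hf : LocallyAC f) : ∀ᵐ t : ℝ, 0 ≤ t → DifferentiableAt ℝ f t := by
  have h : ∀ n : ℕ, ∀ᵐ t : ℝ, t ∈ Set.uIcc (0 : ℝ) n → DifferentiableAt ℝ f t := fun n =>
    (hf n n.cast_nonneg).ae_differentiableAt
  filter_upwards [ae_all_iff.2 h] with t ht ht0
  obtain ⟨n, hn⟩ := exists_nat_ge t
  exact ht n (by rw [Set.uIcc_of_le n.cast_nonneg]; exact ⟨ht0, hn⟩)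

/-- The derivative is merely locally integrable, so the singular integral need not converge at every
time. Almost every section of the integrable double integrand is integrable, and the weight
`rlKernel α (n - t)` can be divided out for `t < n`; countably many `n` suffice. Additivity of the
Caputo derivative rests on this. -/
theorem ae_integrableOn_rlKernel_mul_deriv (hf : LocallyAC f) {α : ℝ} (hα : 0 < α) (hα1 : α < 1) :
    ∀ᵐ t : ℝ, 0 < t → IntegrableOn (fun τ => rlKernel (1 - α) (t - τ) * deriv f τ) (Set.Ioi 0) := by
  have h : ∀ n : ℕ, ∀ᵐ t : ℝ, t ∈ Set.Ioi (0 : ℝ) → IntegrableOn (fun τ =>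
      rlKernel α (n - t) * (rlKernel (1 - α) (t - τ) * deriv f τ)) (Set.Ioi 0) := by
    intro n
    rw [← ae_restrict_iff' measurableSet_Ioi]
    exact (integrable_rlKernel_iterated hα hα1 (measurable_deriv f)
      (hf.integrableOn_deriv n.cast_nonneg)).prod_right_ae
  filter_upwards [ae_all_iff.2 h] with t ht ht0
  obtain ⟨n, hn⟩ := exists_nat_gt t
  have hpos : rlKernel α (n - t) ≠ 0 := by
    rw [rlKernel_of_pos (sub_pos.2 hn)]
    exact (div_pos (Real.rpow_pos_of_pos (sub_pos.2 hn) _) (Real.Gamma_pos_of_pos hα)).ne'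
  have := (ht n ht0).const_mul (rlKernel α (n - t))⁻¹
  simp only [inv_mul_cancel_left₀ hpos] at this
  exact this

/-- A fractional differential equation for an absolutely continuous function yields a
Volterra equation. -/
theorem eq_add_volterraConv (hf : LocallyAC f) {α : ℝ} (hα : 0 < α) (hα1 : α ≤ 1) {v : ℝ → ℝ}
    (hv : ∀ᵐ t ∂(volume.restrict (Set.Ici (0 : ℝ))), caputoDeriv α f t = v t) {t : ℝ}
    (ht : 0 ≤ t) : f t = f 0 + volterraConv (rlKernel α) v t := by
  rw [ae_restrict_iff' measurableSet_Ici] at hv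
  have hftc := (hf t ht).integral_deriv_eq_sub
  rcases eq_or_lt_of_le hα1 with rfl | hα1
  · have h : volterraConv (rlKernel 1) v t = volterraConv (rlKernel 1) (deriv f) t := by
      refine volterraConv_congr (fun x hx => rlKernel_of_nonpos hx) ?_
      filter_upwards [hv] with s hs h1 _
      rw [← hs h1.le, caputoDeriv, if_pos rfl]
    rw [h, volterraConv_rlKernel_one ht, hftc]
    ring
  · have h : volterraConv (rlKernel α) v t
        = volterraConv (rlKernel α) (volterraConv (rlKernel (1 - α)) (deriv f)) t := by
      refine volterraConv_congr (fun x hx => rlKernel_of_nonpos hx) ?_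
      filter_upwards [hv] with s hs h1 _
      rw [← hs h1.le, caputoDeriv_eq_volterraConv _ hα1.ne h1.le]
    rw [h, volterraConv_rlKernel_rlKernel hα hα1 (measurable_deriv f) (hf.integrableOn_deriv ht) ht,
      hftc]
    ring

theorem sum {ι : Type*} (s : Finset ι) (c : ι → ℝ) {x : ι → ℝ → ℝ} (h : ∀ i, LocallyAC (x i)) :
    LocallyAC (fun t => ∑ i ∈ s, c i * x i t) := by
  classical
  intro T hT
  induction s using Finset.induction_on with
  | empty =>
    simp only [Finset.sum_empty]
    exact (contDiff_const (c := (0 : ℝ))).contDiffOn.absolutelyContinuousOnInterval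
  | insert i s hi ih =>
    simp only [Finset.sum_insert hi]
    exact ((h i T hT).const_mul (c i)).add ih

end LocallyAC

/-- The Caputo derivative is linear on locally absolutely continuous functions, almost
everywhere. -/
theorem ae_caputoDeriv_sum {ι : Type*} (s : Finset ι) (c : ι → ℝ) {x : ι → ℝ → ℝ}
    [Finite ι] {α : ℝ} (hα : 0 < α) (hα1 : α ≤ 1) (h : ∀ i, LocallyAC (x i)) :
    ∀ᵐ t ∂(volume.restrict (Set.Ici (0 : ℝ))),
      caputoDeriv α (fun r => ∑ i ∈ s, c i * x i r) t = ∑ i ∈ s, c i * caputoDeriv α (x i) t := by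
  rw [ae_restrict_iff' measurableSet_Ici]
  have hne : ∀ᵐ t : ℝ, t ≠ 0 := by simp [ae_iff, measure_singleton]
  have hder : ∀ᵐ t : ℝ, 0 ≤ t →
      deriv (fun r => ∑ i ∈ s, c i * x i r) t = ∑ i ∈ s, c i * deriv (x i) t := by
    filter_upwards [ae_all_iff.2 fun i => (h i).ae_differentiableAt] with t ht ht0
    rw [deriv_fun_sum fun i _ => (ht i ht0).const_mul (c i)]
    exact Finset.sum_congr rfl fun i _ => deriv_const_mul _ (ht i ht0)
  rcases eq_or_lt_of_le hα1 with rfl | hα1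
  · filter_upwards [hder] with t ht ht0
    simp only [caputoDeriv, if_pos]
    exact ht ht0
  · filter_upwards [hne, ae_all_iff.2 fun i => (h i).ae_integrableOn_rlKernel_mul_deriv hα hα1]
      with t hne ht ht0
    have ht0' : 0 < t := lt_of_le_of_ne ht0 (Ne.symm hne)
    simp only [caputoDeriv_eq_volterraConv _ hα1.ne ht0]
    rw [volterraConv_congr (w := fun τ => ∑ i ∈ s, c i * deriv (x i) τ)
      (fun x hx => rlKernel_of_nonpos hx) (by filter_upwards [hder] with τ hτ h1 _ using hτ h1.le)]
    unfold volterraConv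
    simp only [Finset.mul_sum, mul_left_comm _ (c _)]
    rw [integral_finsetSum _ fun i _ => (ht i ht0').const_mul (c i)]
    simp only [integral_const_mul]

/-- Fractional Grönwall inequality in exponential form. -/
theorem abs_le_of_volterra_le {α b r : ℝ} (hα : 0 < α) (hα1 : α ≤ 1) (hb : 0 ≤ b) (hr : 0 < r)
    (hbr : b * (r ^ α)⁻¹ ≤ 1 / 2) {x v : ℝ → ℝ} {x₀ : ℝ} (hx : ContinuousOn x (Set.Ici 0))
    (hv : ∀ s, 0 ≤ s → |v s| ≤ b * |x s|)
    (heq : ∀ t, 0 ≤ t → x t = x₀ + volterraConv (rlKernel α) v t) {t : ℝ} (ht : 0 ≤ t) :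
    |x t| ≤ 2 * |x₀| * Real.exp (r * t) := by
  have hk := isVolterraKernel_temperedKernel hα hα1 hr.le
  have hcont : ContinuousOn (fun s => Real.exp (-r * s) * |x s|) (Set.Icc 0 t) :=
    (Continuous.continuousOn (by fun_prop)).mul (hx.mono Set.Icc_subset_Ici_self).abs
  -- Maximizing `e^(-rs)|x s|` turns the kernel into its tempered version, whose mass `r^(-α)` is
  -- small enough for half of the maximum to be absorbed.
  obtain ⟨t1, ⟨h10, h1t⟩, hmax⟩ := isCompact_Icc.exists_isMaxOn (Set.nonempty_Icc.2 ht) hcont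
  set M := Real.exp (-r * t1) * |x t1| with hM
  have hM0 : 0 ≤ M := mul_nonneg (Real.exp_pos _).le (abs_nonneg _)
  have hbound : ∀ s, 0 ≤ s → s ≤ t → |x s| ≤ Real.exp (r * s) * M := by
    intro s h0 h1
    have h2 : Real.exp (-r * s) * |x s| ≤ M := hmax ⟨h0, h1⟩
    have h3 := mul_le_mul_of_nonneg_left h2 (Real.exp_pos (r * s)).le
    rwa [← mul_assoc, ← Real.exp_add, show r * s + -r * s = 0 by ring, Real.exp_zero,
      one_mul] at h3
  have hconv : |volterraConv (rlKernel α) v t1| ≤ Real.exp (r * t1) * (M / 2) := by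
    have h1 : |volterraConv (rlKernel α) v t1|
        ≤ ∫ s in Set.Ioi (0 : ℝ), temperedKernel α r (t1 - s) * (Real.exp (r * t1) * b * M) := by
      rw [← Real.norm_eq_abs]
      refine norm_integral_le_of_norm_le ((hk.integrableOn_comp_sub t1 0).mul_const _) ?_
      filter_upwards [ae_restrict_mem measurableSet_Ioi] with s hs
      have hs : 0 < s := hs
      rw [norm_mul, Real.norm_of_nonneg (rlKernel_nonneg hα _), Real.norm_eq_abs]
      rcases lt_or_ge s t1 with h | h
      · have h2 : |v s| ≤ b * (Real.exp (r * s) * M) := (hv s hs.le).trans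
          (mul_le_mul_of_nonneg_left (hbound s hs.le (by linarith)) hb)
        have h3 : Real.exp (-r * (t1 - s)) * Real.exp (r * t1) = Real.exp (r * s) := by
          rw [← Real.exp_add]; ring_nf
        calc rlKernel α (t1 - s) * |v s|
            ≤ rlKernel α (t1 - s) * (b * (Real.exp (r * s) * M)) :=
              mul_le_mul_of_nonneg_left h2 (rlKernel_nonneg hα _)
          _ = _ := by rw [← h3, temperedKernel]; ring
      · have h2 : t1 - s ≤ 0 := by linarith
        rw [temperedKernel, rlKernel_of_nonpos h2]
        simp
    have h2 : kernelMass (temperedKernel α r) (t1 - 0) ≤ (r ^ α)⁻¹ := by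
      obtain ⟨hI, hv⟩ := integral_temperedKernel hα hr
      rw [← hv]
      exact setIntegral_le_integral hI (Eventually.of_forall hk.nonneg)
    rw [integral_mul_const, setIntegral_comp_sub_eq_kernelMass] at h1
    refine h1.trans ?_
    have hE := Real.exp_pos (r * t1)
    calc _ ≤ (r ^ α)⁻¹ * (Real.exp (r * t1) * b * M) :=
          mul_le_mul_of_nonneg_right h2 (by positivity)
      _ = Real.exp (r * t1) * M * (b * (r ^ α)⁻¹) := by ring
      _ ≤ Real.exp (r * t1) * M * (1 / 2) := mul_le_mul_of_nonneg_left hbr (by positivity)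
      _ = _ := by ring
  have hM2 : M ≤ |x₀| + M / 2 := by
    have h1 : |x t1| ≤ |x₀| + Real.exp (r * t1) * (M / 2) := by
      rw [heq t1 h10]
      exact (abs_add_le _ _).trans (add_le_add le_rfl hconv)
    calc M ≤ Real.exp (-r * t1) * (|x₀| + Real.exp (r * t1) * (M / 2)) :=
          mul_le_mul_of_nonneg_left h1 (Real.exp_pos _).le
      _ = Real.exp (-r * t1) * |x₀| + M / 2 := by
          rw [mul_add, ← mul_assoc, ← Real.exp_add, show -r * t1 + r * t1 = 0 by ring,
            Real.exp_zero, one_mul]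
      _ ≤ |x₀| + M / 2 := by
          have : Real.exp (-r * t1) ≤ 1 := Real.exp_le_one_iff.2 (by nlinarith)
          have := mul_le_of_le_one_left (abs_nonneg x₀) this
          linarith
  calc |x t| ≤ Real.exp (r * t) * M := hbound t ht le_rfl
    _ ≤ Real.exp (r * t) * (2 * |x₀|) :=
        mul_le_mul_of_nonneg_left (by linarith) (Real.exp_pos _).le
    _ = _ := by ring

/-! ### Dichotomous noise and its loss of memory -/

namespace IsDichotomousNoise

variable {Ω : Type*} {m : MeasurableSpace Ω} {μ : Measure Ω}
  {F : Filtration ℝ m} {σ lam : ℝ} {ξ : ℝ → Ω → ℝ}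

theorem abs_eq (hξ : IsDichotomousNoise μ F σ lam ξ) (hσ : 0 < σ) {t : ℝ} (ht : 0 ≤ t) (w : Ω) :
    |ξ t w| = σ := by
  rcases hξ.values t ht w with h | h <;> rw [h]
  · exact abs_of_pos hσ
  · rw [abs_neg, abs_of_pos hσ]

theorem measurable_at (hξ : IsDichotomousNoise μ F σ lam ξ) {t : ℝ} (ht : 0 ≤ t) :
    Measurable (ξ t) := (hξ.adapted t ht).mono (F.le t) le_rfl

theorem integrable_mul (hξ : IsDichotomousNoise μ F σ lam ξ) (hσ : 0 < σ) {t : ℝ} (ht : 0 ≤ t)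
    {Y : Ω → ℝ} (hY : Integrable Y μ) : Integrable (fun w => ξ t w * Y w) μ :=
  hY.bdd_mul (hξ.measurable_at ht).aestronglyMeasurable
    (Eventually.of_forall fun w => (hξ.abs_eq hσ ht w).le)

variable [IsProbabilityMeasure μ]

/-- The transition probability of dichotomous noise. -/
theorem condExp_indicator (hξ : IsDichotomousNoise μ F σ lam ξ) (hσ : 0 < σ) {s t : ℝ}
    (hs : 0 ≤ s) (hst : s ≤ t) :
    μ⟦ξ t ⁻¹' {σ} | F s⟧
      =ᵐ[μ] fun w => 1 / 2 + Real.exp (-lam * (t - s)) / (2 * σ) * ξ s w := by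
  have ht : 0 ≤ t := hs.trans hst
  refine (hξ.markov s t hs hst {σ} (measurableSet_singleton σ)).trans (EventuallyEq.symm ?_)
  set e := Real.exp (-lam * (t - s)) with he
  have hms : MeasurableSpace.comap (ξ s) (borel ℝ) ≤ m := by
    have := (hξ.measurable_at hs).comap_le
    rwa [BorelSpace.measurable_eq (α := ℝ)] at this
  have hmt : MeasurableSet (ξ t ⁻¹' {σ}) := hξ.measurable_at ht (measurableSet_singleton σ)
  have hone : Integrable (fun _ : Ω => (1 : ℝ)) μ := integrable_const _
  have hit : Integrable (ξ t) μ := by simpa using hξ.integrable_mul hσ ht hone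
  have his : Integrable (ξ s) μ := by simpa using hξ.integrable_mul hσ hs hone
  have hits : Integrable (fun w => ξ t w * ξ s w) μ := hξ.integrable_mul hσ ht his
  have hss : ∀ w, ξ s w * ξ s w = σ ^ 2 := fun w => by
    rcases hξ.values s hs w with h | h <;> rw [h] <;> ring
  have hcorr : ∫ w, ξ t w * ξ s w ∂μ = σ ^ 2 * e := by
    rw [hξ.correlation s t hs ht, abs_of_nonneg (sub_nonneg.2 hst)]
  have hind : ∀ w, (ξ t ⁻¹' {σ}).indicator (fun _ => (1 : ℝ)) w = 1 / 2 + 1 / (2 * σ) * ξ t w := by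
    intro w
    rcases hξ.values t ht w with h | h
    · rw [Set.indicator_of_mem (show w ∈ ξ t ⁻¹' {σ} from h), h]
      field_simp; norm_num
    · have : w ∉ ξ t ⁻¹' {σ} := fun h' => by
        have h' : ξ t w = σ := h'
        linarith
      rw [Set.indicator_of_notMem this, h]
      field_simp; norm_num
  have hfi : Integrable (fun w => 1 / 2 + e / (2 * σ) * ξ s w) μ :=
    (integrable_const _).add (his.const_mul _)
  refine ae_eq_condExp_of_forall_setIntegral_eq hms ((integrable_const _).indicator hmt)
    (fun _ _ _ => hfi.integrableOn) ?_ ?_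
  · rintro A ⟨B, hB, rfl⟩ -
    have hBm : MeasurableSet B := by
      rwa [BorelSpace.measurable_eq (α := ℝ)]
    have hA : MeasurableSet (ξ s ⁻¹' B) := hξ.measurable_at hs hBm
    -- On a two-point value set every function is affine. So the indicator of any event generated by
    -- `ξ s` is `p + q ξ s`, and the test integrals need only the mean and the correlation.
    obtain ⟨p, q, hpq⟩ : ∃ p q : ℝ, ∀ w (r : ℝ),
        (ξ s ⁻¹' B).indicator (fun _ => r) w = (p + q * ξ s w) * r := by
      refine ⟨(B.indicator 1 σ + B.indicator 1 (-σ)) / 2,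
        (B.indicator 1 σ - B.indicator 1 (-σ)) / (2 * σ), fun w r => ?_⟩
      have h1 : (ξ s ⁻¹' B).indicator (fun _ => r) w = B.indicator 1 (ξ s w) * r := by
        by_cases h : ξ s w ∈ B
        · rw [Set.indicator_of_mem (show w ∈ ξ s ⁻¹' B from h), Set.indicator_of_mem h]
          simp
        · rw [Set.indicator_of_notMem (show w ∉ ξ s ⁻¹' B from h), Set.indicator_of_notMem h]
          simp
      rw [h1]
      congr 1
      rcases hξ.values s hs w with h | h <;> rw [h] <;> field_simp <;> ring
    have hval : ∀ c d : ℝ, ∀ Z : Ω → ℝ, Integrable Z μ → ∫ w, Z w ∂μ = 0 →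
        Integrable (fun w => Z w * ξ s w) μ →
        ∫ w in ξ s ⁻¹' B, (c + d * Z w) ∂μ = p * c + q * d * ∫ w, Z w * ξ s w ∂μ := by
      intro c d Z hZ hZ0 hZs
      have h0 : ∫ w, ξ s w ∂μ = 0 := hξ.mean s hs
      rw [← integral_indicator hA]
      have h1 : (fun w => (ξ s ⁻¹' B).indicator (fun w => c + d * Z w) w)
          = fun w => (p * c + q * c * ξ s w) + (p * d * Z w + q * d * (Z w * ξ s w)) := by
        ext w
        have h2 : (ξ s ⁻¹' B).indicator (fun w => c + d * Z w) w
            = (ξ s ⁻¹' B).indicator (fun _ => c + d * Z w) w := by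
          simp only [Set.indicator]
        rw [h2, hpq]
        ring
      have hi1 : Integrable (fun w => p * c + q * c * ξ s w) μ :=
        (integrable_const _).add (his.const_mul _)
      have hi2 : Integrable (fun w => p * d * Z w + q * d * (Z w * ξ s w)) μ :=
        (hZ.const_mul _).add (hZs.const_mul _)
      rw [h1, integral_add hi1 hi2,
        integral_add (integrable_const _) (his.const_mul _),
        integral_add (hZ.const_mul _) (hZs.const_mul _), integral_const_mul, integral_const_mul,
        integral_const_mul, integral_const_mul, h0, hZ0]
      simp
    simp only [hind]
    rw [hval _ _ _ his (hξ.mean s hs) (hξ.integrable_mul hσ hs his),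
      hval _ _ _ hit (hξ.mean t ht) hits, hcorr]
    simp only [hss]
    simp only [integral_const, probReal_univ, smul_eq_mul]
    field_simp
  · have h1 : @Measurable Ω ℝ (MeasurableSpace.comap (ξ s) (borel ℝ)) _ (ξ s) := by
      intro B hB
      refine ⟨B, ?_, rfl⟩
      rwa [BorelSpace.measurable_eq (α := ℝ)] at hB
    exact (((h1.const_mul _).const_add _).stronglyMeasurable).aestronglyMeasurable

/-- Loss of memory: `⟨ξ_t Y⟩ = exp(-lam (t - s)) ⟨ξ_s Y⟩` when `Y` is known at time `s ≤ t`. -/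
theorem integral_mul_eq (hξ : IsDichotomousNoise μ F σ lam ξ) (hσ : 0 < σ) {s t : ℝ}
    (hs : 0 ≤ s) (hst : s ≤ t) {Y : Ω → ℝ} (hY : Integrable Y μ) (hYm : Measurable[F s] Y) :
    ∫ w, ξ t w * Y w ∂μ = Real.exp (-lam * (t - s)) * ∫ w, ξ s w * Y w ∂μ := by
  have ht : 0 ≤ t := hs.trans hst
  have hmt : MeasurableSet (ξ t ⁻¹' {σ}) := hξ.measurable_at ht (measurableSet_singleton σ)
  set I : Ω → ℝ := (ξ t ⁻¹' {σ}).indicator (fun _ => (1 : ℝ)) with hI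
  have hIi : Integrable I μ := (integrable_const _).indicator hmt
  -- With only two values, `ξ t` is affine in the indicator of `ξ t = σ`, whose conditional
  -- expectation is known.
  have hval : ∀ w, ξ t w = 2 * σ * I w - σ := by
    intro w
    rcases hξ.values t ht w with h | h
    · rw [hI, Set.indicator_of_mem (show w ∈ ξ t ⁻¹' {σ} from h), h]
      ring
    · have : w ∉ ξ t ⁻¹' {σ} := fun h' => by
        have h' : ξ t w = σ := h'
        linarith
      rw [hI, Set.indicator_of_notMem this, h]
      ring
  have hIY : Integrable (I * Y) μ := by
    refine hY.bdd_mul (c := 1) hIi.aestronglyMeasurable (Eventually.of_forall fun w => ?_)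
    rw [hI]
    by_cases h : w ∈ ξ t ⁻¹' {σ}
    · rw [Set.indicator_of_mem h]; simp
    · rw [Set.indicator_of_notMem h]; simp
  have hpull : ∫ w, I w * Y w ∂μ
      = ∫ w, (1 / 2 + Real.exp (-lam * (t - s)) / (2 * σ) * ξ s w) * Y w ∂μ := by
    have h1 := condExp_mul_of_stronglyMeasurable_right (μ := μ) (m := F s) hYm.stronglyMeasurable
      hIY hIi
    have h2 : ∫ w, I w * Y w ∂μ = ∫ w, (μ[I * Y | F s]) w ∂μ := (integral_condExp (F.le s)).symm
    rw [h2]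
    refine integral_congr_ae ?_
    filter_upwards [h1, hξ.condExp_indicator hσ hs hst] with w h3 h4
    rw [h3, Pi.mul_apply, h4]
  have hsY := hξ.integrable_mul hσ hs hY
  have hIY' : Integrable (fun w => I w * Y w) μ := hIY
  have e1 : ∫ w, ξ t w * Y w ∂μ = 2 * σ * ∫ w, I w * Y w ∂μ - σ * ∫ w, Y w ∂μ := by
    rw [← integral_const_mul, ← integral_const_mul, ← integral_sub (hIY'.const_mul _)
      (hY.const_mul _)]
    refine integral_congr_ae (Eventually.of_forall fun w => ?_)
    simp only [hval w]
    ring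
  have e2 : ∫ w, (1 / 2 + Real.exp (-lam * (t - s)) / (2 * σ) * ξ s w) * Y w ∂μ
      = 1 / 2 * ∫ w, Y w ∂μ + Real.exp (-lam * (t - s)) / (2 * σ) * ∫ w, ξ s w * Y w ∂μ := by
    rw [← integral_const_mul, ← integral_const_mul, ← integral_add (hY.const_mul _)
      (hsY.const_mul _)]
    refine integral_congr_ae (Eventually.of_forall fun w => ?_)
    simp only
    ring
  rw [e1, hpull, e2]
  field_simp
  ring

end IsDichotomousNoise

/-! ### Moments of the homogeneous equation -/

section HomogeneousEquation

variable {Ω : Type*} {m : MeasurableSpace Ω} {μ : Measure Ω} {F : Filtration ℝ m}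
  {σ lam α a : ℝ} {ξ Δ : ℝ → Ω → ℝ}

/-- A jointly measurable version, all of whose paths solve the Volterra equation and grow at most
exponentially. -/
theorem IsHomogeneousSolution.exists_version (hξ : IsDichotomousNoise μ F σ lam ξ)
    (hα : 0 < α) (hα1 : α ≤ 1) (hσ : 0 < σ) (ha : 0 ≤ a)
    (hΔ : IsHomogeneousSolution μ F α a ξ Δ) :
    ∃ X : ℝ → Ω → ℝ, Measurable (Function.uncurry X) ∧ (∀ t, 0 ≤ t → X t =ᵐ[μ] Δ t) ∧
      ∃ r, 0 < r ∧ (∀ t, 0 ≤ t → ∀ w, |X t w| ≤ 2 * |X 0 w| * Real.exp (r * t)) ∧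
        ∀ t, 0 ≤ t → ∀ w, X t w = X 0 w
          + volterraConv (rlKernel α) (fun s => -((a + ξ s w) * X s w)) t := by
  have hb : 0 < a + σ := by linarith
  -- Chosen so that `r^α = 2(a + σ)`, where `a + σ` bounds the random coefficient; this is the
  -- smallness condition of the Grönwall bound.
  set r : ℝ := (2 * (a + σ)) ^ (1 / α) with hr
  have hr0 : 0 < r := Real.rpow_pos_of_pos (by positivity) _
  have hrα : r ^ α = 2 * (a + σ) := by
    rw [hr, ← Real.rpow_mul (by positivity), one_div_mul_cancel hα.ne', Real.rpow_one]
  have hbr : (a + σ) * (r ^ α)⁻¹ ≤ 1 / 2 := by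
    rw [hrα]
    apply le_of_eq
    field_simp
  have hgood : ∀ᵐ w ∂μ, LocallyAC (fun t => Δ t w) ∧
      ∀ᵐ t ∂(volume.restrict (Set.Ici (0 : ℝ))),
        caputoDeriv α (fun s => Δ s w) t + (a + ξ t w) * Δ t w = 0 :=
    (hΔ.admissible.absolutelyContinuous ()).and hΔ.equation
  obtain ⟨G, hG, hGm, hGP⟩ := hgood.exists_measurable_mem
  have hmax : ∀ t : ℝ, 0 ≤ max t 0 := fun t => le_max_right _ _
  have hvolt : ∀ w ∈ G, ∀ t, 0 ≤ t → Δ t w = Δ 0 w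
      + volterraConv (rlKernel α) (fun s => -((a + ξ s w) * Δ s w)) t := by
    intro w hw t ht
    obtain ⟨hAC, heq⟩ := hGP w hw
    refine hAC.eq_add_volterraConv hα hα1 ?_ ht
    filter_upwards [heq] with s hs
    linarith
  have hpath : ∀ w ∈ G, Continuous fun t => Δ (max t 0) w := fun w hw =>
    (hGP w hw).1.continuousOn.comp_continuous (continuous_id.max continuous_const) hmax
  -- Paths are frozen at negative times and set to zero off a measurable full event, so they are
  -- continuous on all of `ℝ`; continuity in `t` and measurability in `w` give joint measurability.
  refine ⟨fun t w => G.indicator (Δ (max t 0)) w, ?_, fun t ht => ?_, r, hr0, ?_, ?_⟩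
  · have hc : ∀ w, Continuous fun t => G.indicator (Δ (max t 0)) w := by
      intro w
      by_cases hw : w ∈ G
      · simp only [Set.indicator_of_mem hw]
        exact hpath w hw
      · simp only [Set.indicator_of_notMem hw]
        exact continuous_const
    have hm : ∀ t, Measurable (G.indicator (Δ (max t 0))) := fun t =>
      (((hΔ.admissible.adapted () _ (hmax t)).mono (F.le _) le_rfl)).indicator hGm
    exact measurable_uncurry_of_continuous_of_measurable hc hm
  · filter_upwards [hG] with w hw
    simp only [Set.indicator_of_mem hw, max_eq_left ht]
  · intro t ht w
    by_cases hw : w ∈ G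
    · simp only [Set.indicator_of_mem hw, max_eq_left ht, max_self]
      refine abs_le_of_volterra_le hα hα1 hb.le hr0 hbr (hGP w hw).1.continuousOn
        (fun s hs => ?_) (hvolt w hw) ht
      rw [abs_neg, abs_mul]
      refine mul_le_mul_of_nonneg_right ((abs_add_le _ _).trans ?_) (abs_nonneg _)
      rw [abs_of_nonneg ha, hξ.abs_eq hσ hs]
    · simp only [Set.indicator_of_notMem hw]
      simp
  · intro t ht w
    by_cases hw : w ∈ G
    · simp only [Set.indicator_of_mem hw, max_eq_left ht, max_self]
      rw [hvolt w hw t ht]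
      congr 1
      refine volterraConv_congr (fun x hx => rlKernel_of_nonpos hx)
        (Eventually.of_forall fun s h1 _ => ?_)
      rw [max_eq_left h1.le]
    · simp only [Set.indicator_of_notMem hw]
      simp [volterraConv]

/-- Fubini with majorant `C Y(w) κ(t - s)`. The weight `η` is independent of `s`, which allows the
noise at the final time `t` as a test variable. -/
theorem integral_mul_volterraConv [IsFiniteMeasure μ] {κ : ℝ → ℝ} (hκ : IsVolterraKernel κ)
    {V : ℝ → Ω → ℝ} (hV : Measurable (Function.uncurry V)) {η Y : Ω → ℝ} (hη : Measurable η)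
    {C t : ℝ} (hηC : ∀ w, |η w| ≤ C) (hY : Integrable Y μ)
    (hVY : ∀ s, 0 < s → s < t → ∀ w, |V s w| ≤ Y w) :
    ∫ w, η w * volterraConv κ (fun s => V s w) t ∂μ
      = volterraConv κ (fun s => ∫ w, η w * V s w ∂μ) t := by
  have hm : Measurable (fun p : Ω × ℝ => κ (t - p.2) * (η p.1 * V p.2 p.1)) :=
    (hκ.measurable.comp (measurable_const.sub measurable_snd)).mul
      ((hη.comp measurable_fst).mul (hV.comp measurable_swap))
  have hint : Integrable (fun p : Ω × ℝ => κ (t - p.2) * (η p.1 * V p.2 p.1))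
      (μ.prod (volume.restrict (Set.Ioi 0))) := by
    have hdom : Integrable (fun p : Ω × ℝ => (C * Y p.1) * κ (t - p.2))
        (μ.prod (volume.restrict (Set.Ioi 0))) :=
      (hY.const_mul C).mul_prod (hκ.integrableOn_comp_sub t 0)
    refine hdom.mono' hm.aestronglyMeasurable ?_
    have hpos : ∀ᵐ p ∂(μ.prod (volume.restrict (Set.Ioi (0 : ℝ)))), 0 < p.2 := by
      have h : ∀ᵐ s ∂(volume.restrict (Set.Ioi (0 : ℝ))), 0 < s :=
        ae_restrict_mem measurableSet_Ioi
      exact Measure.quasiMeasurePreserving_snd.ae h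
    filter_upwards [hpos] with p hp
    rw [norm_mul, Real.norm_of_nonneg (hκ.nonneg _), norm_mul, mul_comm]
    rcases lt_or_ge p.2 t with h | h
    · refine mul_le_mul_of_nonneg_right ?_ (hκ.nonneg _)
      exact mul_le_mul (hηC _) (hVY _ hp h _) (norm_nonneg _) ((abs_nonneg _).trans (hηC p.1))
    · simp [hκ.eq_zero (t - p.2) (by linarith)]
  calc ∫ w, η w * volterraConv κ (fun s => V s w) t ∂μ
      = ∫ w, ∫ s in Set.Ioi (0 : ℝ), κ (t - s) * (η w * V s w) ∂volume ∂μ := by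
        simp only [volterraConv, ← integral_const_mul]
        simp only [mul_left_comm]
    _ = ∫ s in Set.Ioi (0 : ℝ), ∫ w, κ (t - s) * (η w * V s w) ∂μ := integral_integral_swap hint
    _ = _ := by simp only [volterraConv, integral_const_mul]

/-- Below the threshold `a² + lam^α a`, solutions of the homogeneous equation vanish in mean. -/
theorem IsHomogeneousSolution.meanTendstoZero [IsProbabilityMeasure μ]
    (hξ : IsDichotomousNoise μ F σ lam ξ) (hα : 0 < α) (hα1 : α ≤ 1) (hσ : 0 < σ)
    (hlam : 0 < lam) (ha : 0 ≤ a) (hlt : σ ^ 2 < a ^ 2 + lam ^ α * a)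
    (hΔ : IsHomogeneousSolution μ F α a ξ Δ) : MeanTendstoZero μ Δ := by
  obtain ⟨X, hXm, hXΔ, r, hr, hXb, hXeq⟩ := hΔ.exists_version hξ hα hα1 hσ ha
  have hX0 : Integrable (X 0) μ :=
    (hΔ.admissible.integrable_zero ()).congr (hXΔ 0 le_rfl).symm
  have hXtm : ∀ t, Measurable (X t) := fun t => hXm.comp measurable_prodMk_left
  have hXi : ∀ t, 0 ≤ t → Integrable (X t) μ := fun t ht =>
    ((hX0.abs.const_mul 2).mul_const (Real.exp (r * t))).mono' (hXtm t).aestronglyMeasurable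
      (Eventually.of_forall fun w => hXb t ht w)
  refine ⟨fun t ht => (hXi t ht).congr (hXΔ t ht), ?_⟩
  -- the noise, frozen at negative times
  set Ξ : ℝ → Ω → ℝ := fun t w => ξ (max t 0) w with hΞ
  have hΞm : Measurable (Function.uncurry Ξ) := by
    have h1 : Measurable (fun p : ℝ × Ω =>
        ((⟨max p.1 0, Set.mem_Ici.2 (le_max_right _ _)⟩ : Set.Ici (0 : ℝ)), p.2)) :=
      (Measurable.subtype_mk (measurable_fst.max measurable_const)).prodMk measurable_snd
    exact hξ.measurable.comp h1
  have hΞt : ∀ t, 0 ≤ t → Ξ t = ξ t := fun t ht => by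
    simp only [hΞ, max_eq_left ht]
  have hΞtm : ∀ t, Measurable (Ξ t) := fun t => hΞm.comp measurable_prodMk_left
  have hΞabs : ∀ t w, |Ξ t w| = σ := fun t w => hξ.abs_eq hσ (le_max_right _ _) w
  have hΞsq : ∀ t w, Ξ t w * Ξ t w = σ ^ 2 := fun t w => by
    rw [← sq, ← sq_abs, hΞabs]
  set V : ℝ → Ω → ℝ := fun s w => -((a + Ξ s w) * X s w) with hVdef
  have hVm : Measurable (Function.uncurry V) := ((hΞm.const_add a).mul hXm).neg
  have hXeq' : ∀ t, 0 ≤ t → ∀ w, X t w = X 0 w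
      + volterraConv (rlKernel α) (fun s => V s w) t := fun t ht w => by
    rw [hXeq t ht w]
    congr 1
    refine volterraConv_congr (fun x hx => rlKernel_of_nonpos hx)
      (Eventually.of_forall fun s h1 _ => ?_)
    rw [hVdef, ← hΞt s h1.le]
  have hk0 : temperedKernel α 0 = rlKernel α := by
    ext x; simp [temperedKernel]
  have hk := isVolterraKernel_temperedKernel hα hα1 le_rfl
  rw [hk0] at hk
  have hΞXi : ∀ s t, 0 ≤ t → Integrable (fun w => Ξ s w * X t w) μ := fun s t ht =>
    hξ.integrable_mul hσ (le_max_right _ _) (hXi t ht)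
  have hVi : ∀ s, 0 ≤ s → Integrable (V s) μ := fun s hs => by
    refine ((((hXi s hs).const_mul a).add (hΞXi s s hs)).neg).congr
      (Eventually.of_forall fun w => ?_)
    simp only [hVdef, Pi.neg_apply, Pi.add_apply]
    ring
  -- the averaged equation, tested against a bounded random variable
  have hmean : ∀ t, 0 ≤ t → ∀ η : Ω → ℝ, Measurable η → ∀ C, (∀ w, |η w| ≤ C) →
      ∫ w, η w * X t w ∂μ = ∫ w, η w * X 0 w ∂μ
        + volterraConv (rlKernel α) (fun s => ∫ w, η w * V s w ∂μ) t := by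
    intro t ht η hη C hC
    have hi : ∀ s, 0 ≤ s → Integrable (fun w => η w * X s w) μ := fun s hs =>
      (hXi s hs).bdd_mul hη.aestronglyMeasurable (Eventually.of_forall hC)
    rw [← integral_mul_volterraConv hk hVm hη hC
      (Y := fun w => (a + σ) * (2 * |X 0 w| * Real.exp (r * t)))
      (((hX0.abs.const_mul 2).mul_const _).const_mul _) ?_, ← sub_eq_iff_eq_add',
      ← integral_sub (hi t ht) (hi 0 le_rfl)]
    · refine integral_congr_ae (Eventually.of_forall fun w => ?_)
      simp only
      rw [hXeq' t ht w]
      ring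
    · intro s hs hst w
      rw [hVdef]
      simp only
      rw [abs_neg, abs_mul]
      refine mul_le_mul ((abs_add_le _ _).trans ?_) ((hXb s hs.le w).trans ?_) (abs_nonneg _)
        (by linarith)
      · rw [abs_of_nonneg ha, hΞabs]
      · refine mul_le_mul_of_nonneg_left (Real.exp_le_exp.2 ?_) (by positivity)
        exact mul_le_mul_of_nonneg_left hst.le hr.le
  -- first moments
  set u : ℝ → ℝ := fun t => ∫ w, X t w ∂μ with hu
  set z : ℝ → ℝ := fun t => ∫ w, Ξ t w * X t w ∂μ with hz
  have hum : Measurable u :=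
    (hXm.stronglyMeasurable.integral_prod_right (ν := μ)).measurable
  have hzm : Measurable z :=
    ((hΞm.mul hXm).stronglyMeasurable.integral_prod_right (ν := μ)).measurable
  have hV1 : ∀ s, 0 ≤ s → ∫ w, V s w ∂μ = -(a * u s + z s) := by
    intro s hs
    rw [hu, hz]
    simp only
    rw [← integral_const_mul, ← integral_add ((hXi s hs).const_mul a) (hΞXi s s hs),
      ← integral_neg]
    refine integral_congr_ae (Eventually.of_forall fun w => ?_)
    simp only [hVdef]
    ring
  -- Since `ξ² = σ²`, the second equation returns to the first moment and the hierarchy closes.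
  have hV2 : ∀ s, 0 ≤ s → ∫ w, Ξ s w * V s w ∂μ = -(a * z s + σ ^ 2 * u s) := by
    intro s hs
    rw [hu, hz]
    simp only
    rw [← integral_const_mul, ← integral_const_mul,
      ← integral_add ((hΞXi s s hs).const_mul a) ((hXi s hs).const_mul _), ← integral_neg]
    refine integral_congr_ae (Eventually.of_forall fun w => ?_)
    simp only [hVdef]
    linear_combination (-X s w) * hΞsq s w
  -- loss of memory of the noise
  have hmem : ∀ s t, 0 ≤ s → s ≤ t → ∀ Y Z : Ω → ℝ, Integrable Z μ → Y =ᵐ[μ] Z →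
      Measurable[F s] Z →
      ∫ w, Ξ t w * Y w ∂μ = Real.exp (-lam * (t - s)) * ∫ w, Ξ s w * Y w ∂μ := by
    intro s t hs hst Y Z hZ hYZ hZm
    -- The version `X` was cut off on an event that need not belong to `F s`, so adaptedness is
    -- recovered by passing to an almost surely equal variable.
    have h1 : ∀ q, ∫ w, Ξ q w * Y w ∂μ = ∫ w, Ξ q w * Z w ∂μ := fun q => by
      refine integral_congr_ae ?_
      filter_upwards [hYZ] with w hw
      rw [hw]
    rw [h1, h1, hΞt s hs, hΞt t (hs.trans hst)]
    exact hξ.integral_mul_eq hσ hs hst hZ hZm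
  have hequ : ∀ t, 0 ≤ t → u t = u 0 - volterraConv (rlKernel α) (fun s => a * u s + z s) t := by
    intro t ht
    have h := hmean t ht (fun _ => 1) measurable_const 1 (fun _ => by simp)
    simp only [one_mul] at h
    rw [hu]
    simp only
    rw [h, sub_eq_add_neg]
    congr 1
    unfold volterraConv
    rw [← integral_neg]
    refine setIntegral_congr_fun measurableSet_Ioi fun s hs => ?_
    simp only
    rw [hV1 s (le_of_lt hs)]
    ring
  -- The equation at time `t` is tested with `ξ_t`. Under the integral over `s < t`, loss of memory
  -- replaces `ξ_t` by `e^(-lam(t-s)) ξ_s`, which tempers the kernel.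
  have heqz : ∀ t, 0 ≤ t → z t = z 0 * Real.exp (-lam * t)
      - volterraConv (temperedKernel α lam) (fun s => a * z s + σ ^ 2 * u s) t := by
    intro t ht
    have h := hmean t ht (Ξ t) (hΞtm t) σ (fun w => (hΞabs t w).le)
    have h0 : ∫ w, Ξ t w * X 0 w ∂μ = z 0 * Real.exp (-lam * t) := by
      rw [hmem 0 t le_rfl ht _ (Δ 0) (hΔ.admissible.integrable_zero ()) (hXΔ 0 le_rfl)
        (hΔ.admissible.adapted () 0 le_rfl), sub_zero, mul_comm]
    rw [show z t = ∫ w, Ξ t w * X t w ∂μ from rfl, h, h0, sub_eq_add_neg]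
    congr 1
    unfold volterraConv
    rw [← integral_neg]
    refine setIntegral_congr_fun measurableSet_Ioi fun s hs => ?_
    have hs : 0 < s := hs
    simp only
    rcases lt_or_ge s t with hst | hst
    · have hVZ : V s =ᵐ[μ] fun w => -((a + ξ s w) * Δ s w) := by
        filter_upwards [hXΔ s hs.le] with w hw
        simp only [hVdef, hw, hΞt s hs.le]
      have hZm : Measurable[F s] fun w => -((a + ξ s w) * Δ s w) :=
        (((hξ.adapted s hs.le).const_add a).mul (hΔ.admissible.adapted () s hs.le)).neg
      rw [hmem s t hs.le hst.le (V s) _ ((hVi s hs.le).congr hVZ) hVZ hZm, hV2 s hs.le,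
        temperedKernel]
      ring
    · rw [temperedKernel, rlKernel_of_nonpos (sub_nonpos.2 hst)]
      ring
  have hbu : ∀ T, ∃ B, ∀ s, 0 ≤ s → s ≤ T → |u s| ≤ B ∧ |z s| ≤ σ * B := by
    intro T
    have hle : ∀ s, 0 ≤ s → s ≤ T → ∀ w, |X s w| ≤ 2 * |X 0 w| * Real.exp (r * T) :=
      fun s h0 h1 w => (hXb s h0 w).trans (mul_le_mul_of_nonneg_left
        (Real.exp_le_exp.2 (mul_le_mul_of_nonneg_left h1 hr.le)) (by positivity))
    have hdom : Integrable (fun w => 2 * |X 0 w| * Real.exp (r * T)) μ :=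
      (hX0.abs.const_mul 2).mul_const _
    refine ⟨∫ w, 2 * |X 0 w| * Real.exp (r * T) ∂μ, fun s h0 h1 => ⟨?_, ?_⟩⟩
    · rw [← Real.norm_eq_abs]
      exact norm_integral_le_of_norm_le hdom (Eventually.of_forall fun w => hle s h0 h1 w)
    · rw [← integral_const_mul, ← Real.norm_eq_abs]
      refine norm_integral_le_of_norm_le (hdom.const_mul σ) (Eventually.of_forall fun w => ?_)
      rw [norm_mul, Real.norm_eq_abs, hΞabs]
      exact mul_le_mul_of_nonneg_left (hle s h0 h1 w) hσ.le
  -- rescaling and the small-gain theorem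
  have hlα : 0 < lam ^ α := Real.rpow_pos_of_pos hlam α
  have haσ : σ ^ 2 < a * (a + lam ^ α) := hlt.trans_eq (by ring)
  -- With `z` replaced by `z/c` the couplings become `c` and `σ²/c`. Both lie strictly below the
  -- dampings `a` and `a + lam^α` for a suitable `c` because `σ² < a(a + lam^α)`.
  obtain ⟨c, hc1, hca⟩ : ∃ c, σ ^ 2 / (a + lam ^ α) < c ∧ c < a :=
    exists_between ((div_lt_iff₀ (by linarith)).2 haσ)
  have hc0 : 0 < c := lt_of_le_of_lt (by positivity) hc1
  have hq : σ ^ 2 / c < a + lam ^ α := by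
    rw [div_lt_iff₀ hc0]
    have := (div_lt_iff₀ (by linarith)).1 hc1
    linarith
  have hB0 := isBalayageKernel_temperedKernel hα hα1 (le_refl (0 : ℝ))
  have hBl := isBalayageKernel_temperedKernel hα hα1 hlam.le
  rw [Real.zero_rpow hα.ne', hk0] at hB0
  have hS1 : IsVolterraSolution (rlKernel α) (fun t => Real.exp (-0 * t)) a
      (fun s => c * (z s / c)) (u 0) u := by
    have e : (fun s => c * (z s / c)) = z := by
      ext s; field_simp
    rw [e]
    refine ⟨hum, hzm, fun T => ?_, fun T => ?_, fun t ht => ?_⟩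
    · obtain ⟨B, hB⟩ := hbu T
      exact ⟨B, fun s h0 h1 => (hB s h0 h1).1⟩
    · obtain ⟨B, hB⟩ := hbu T
      exact ⟨σ * B, fun s h0 h1 => (hB s h0 h1).2⟩
    · rw [hequ t ht]
      simp
  have hS2 : IsVolterraSolution (temperedKernel α lam) (fun t => Real.exp (-lam * t)) a
      (fun s => σ ^ 2 / c * u s) (z 0 / c) (fun t => z t / c) := by
    refine ⟨hzm.div_const c, hum.const_mul _, fun T => ?_, fun T => ?_, fun t ht => ?_⟩
    · obtain ⟨B, hB⟩ := hbu T
      refine ⟨σ * B / c, fun s h0 h1 => ?_⟩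
      rw [abs_div, abs_of_pos hc0]
      exact div_le_div_of_nonneg_right (hB s h0 h1).2 hc0.le
    · obtain ⟨B, hB⟩ := hbu T
      refine ⟨σ ^ 2 / c * B, fun s h0 h1 => ?_⟩
      rw [abs_mul, abs_of_pos (by positivity)]
      exact mul_le_mul_of_nonneg_left (hB s h0 h1).1 (by positivity)
    · have e : volterraConv (temperedKernel α lam) (fun s => a * (z s / c) + σ ^ 2 / c * u s) t
          = volterraConv (temperedKernel α lam) (fun s => a * z s + σ ^ 2 * u s) t / c := by
        unfold volterraConv
        rw [← integral_div]
        refine integral_congr_ae (Eventually.of_forall fun s => ?_)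
        simp only
        ring
      rw [e, heqz t ht]
      ring
  have hlim := (tendsto_zero_of_smallGain hB0 hBl ha le_rfl hlα.le hc0.le (by positivity)
    (by linarith) hq hS1 hS2).1
  refine hlim.congr' ?_
  filter_upwards [eventually_ge_atTop 0] with t ht using integral_congr_ae (hXΔ t ht)

end HomogeneousEquation

/-! ### The star network -/

section StarNetwork

variable {Ω : Type*} {m : MeasurableSpace Ω} {μ : Measure Ω} {F : Filtration ℝ m}
  {N : ℕ} {α ω ε A₀ Ω₀ σ lam : ℝ} {ξ : ℝ → Ω → ℝ} {x : Fin (N + 1) → ℝ → Ω → ℝ}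

theorem IsAdmissible.linearCombination {ι : Type*} [Fintype ι] {x : ι → ℝ → Ω → ℝ}
    (hx : IsAdmissible μ F x) {κ : Type*} (c : κ → ι → ℝ) :
    IsAdmissible μ F (fun k t w => ∑ i, c k i * x i t w) where
  adapted k t ht := Finset.measurable_sum _ fun i _ => (hx.adapted i t ht).const_mul (c k i)
  integrable_zero k := integrable_finsetSum _ fun i _ => (hx.integrable_zero i).const_mul (c k i)
  absolutelyContinuous k := by
    filter_upwards [ae_all_iff.2 hx.absolutelyContinuous] with w hw
    exact LocallyAC.sum Finset.univ (c k) (x := fun i t => x i t w) hw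

/-- Coefficients of the deviation of particle `j` from the mean field. -/
noncomputable def deviationCoeff (N : ℕ) (j i : Fin (N + 1)) : ℝ :=
  (if i = j then 1 else 0) - 1 / ((N : ℝ) + 1)

theorem sum_deviationCoeff_mul (j : Fin (N + 1)) (y : Fin (N + 1) → ℝ) :
    ∑ i, deviationCoeff N j i * y i = y j - (∑ i, y i) / ((N : ℝ) + 1) := by
  simp only [deviationCoeff, sub_mul, Finset.sum_sub_distrib, ite_mul, one_mul, zero_mul,
    Finset.sum_ite_eq', Finset.mem_univ, if_true, ← Finset.mul_sum]
  ring

theorem deviation_eq_sum (x : Fin (N + 1) → ℝ → Ω → ℝ) :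
    deviation x = fun j t w => ∑ i, deviationCoeff N j i * x i t w := by
  ext j t w
  rw [sum_deviationCoeff_mul, deviation, meanField]

theorem sum_deviation (x : Fin (N + 1) → ℝ → Ω → ℝ) (t : ℝ) (w : Ω) :
    ∑ i, deviation x i t w = 0 := by
  have : (N : ℝ) + 1 ≠ 0 := by positivity
  simp only [deviation, meanField, Finset.sum_sub_distrib, Finset.sum_const, Finset.card_univ,
    Fintype.card_fin, nsmul_eq_mul]
  push_cast
  field_simp
  ring

theorem sum_succ_deviation (x : Fin (N + 1) → ℝ → Ω → ℝ) (t : ℝ) (w : Ω) :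
    ∑ k : Fin N, deviation x k.succ t w = -deviation x 0 t w := by
  have := sum_deviation x t w
  rw [Fin.sum_univ_succ] at this
  linarith

/-- The coupling force in the star, in terms of the deviations from the mean field. -/
noncomputable def starForce (x : Fin (N + 1) → ℝ → Ω → ℝ) (i : Fin (N + 1)) (t : ℝ) (w : Ω) : ℝ :=
  if i = 0 then -((N : ℝ) + 1) * deviation x 0 t w else deviation x 0 t w - deviation x i t w

/-- Mutual forces cancel, so the coupling does not act on the mean field and each deviation feels
exactly the force on its particle. -/
theorem sum_starForce (x : Fin (N + 1) → ℝ → Ω → ℝ) (t : ℝ) (w : Ω) :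
    ∑ i, starForce x i t w = 0 := by
  rw [Fin.sum_univ_succ]
  simp only [starForce, if_true, Fin.succ_ne_zero, if_false, Finset.sum_sub_distrib,
    Finset.sum_const, Finset.card_univ, Fintype.card_fin, nsmul_eq_mul, sum_succ_deviation]
  ring

theorem IsStarSolution.ae_caputoDeriv (hx : IsStarSolution μ F N α ω ε A₀ Ω₀ ξ x) :
    ∀ᵐ w ∂μ, ∀ᵐ t ∂(volume.restrict (Set.Ici (0 : ℝ))), ∀ i,
      caputoDeriv α (fun r => x i r w) t
        = A₀ * Real.sin (Ω₀ * t) - (ω + ξ t w) * x i t w + ε * starForce x i t w := by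
  filter_upwards [hx.main, ae_all_iff.2 hx.peripheral] with w h0 hp
  filter_upwards [h0, ae_all_iff.2 hp] with t h0 hp
  refine fun i => Fin.cases ?_ (fun k => ?_) i
  · have e : ∑ k : Fin N, (x k.succ t w - x 0 t w) = starForce x 0 t w := by
      have e1 : ∀ k : Fin N, x k.succ t w - x 0 t w
          = deviation x k.succ t w - deviation x 0 t w := fun k => by
        simp only [deviation]; ring
      simp only [e1, starForce, if_true, Finset.sum_sub_distrib, sum_succ_deviation,
        Finset.sum_const, Finset.card_univ, Fintype.card_fin, nsmul_eq_mul]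
      ring
    rw [e] at h0
    linear_combination h0
  · have := hp k
    simp only [starForce, if_neg (Fin.succ_ne_zero k), deviation]
    linear_combination this

/-- The coupled equations of the deviations from the mean field. -/
theorem IsStarSolution.ae_caputoDeriv_deviation (hα : 0 < α) (hα1 : α ≤ 1)
    (hx : IsStarSolution μ F N α ω ε A₀ Ω₀ ξ x) :
    ∀ᵐ w ∂μ, ∀ᵐ t ∂(volume.restrict (Set.Ici (0 : ℝ))), ∀ j,
      caputoDeriv α (fun r => deviation x j r w) t
        = -(ω + ξ t w) * deviation x j t w + ε * starForce x j t w := by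
  filter_upwards [hx.ae_caputoDeriv, ae_all_iff.2 hx.admissible.absolutelyContinuous] with w h1 h2
  filter_upwards [h1, ae_all_iff.2 fun j => ae_caputoDeriv_sum Finset.univ (deviationCoeff N j)
    hα hα1 (x := fun i t => x i t w) h2] with t h3 h4 j
  have hN : (N : ℝ) + 1 ≠ 0 := by positivity
  rw [deviation_eq_sum, h4 j]
  simp only [h3, sum_deviationCoeff_mul, Finset.sum_add_distrib, Finset.sum_sub_distrib,
    ← Finset.mul_sum, sum_starForce, Finset.sum_const, Finset.card_univ, Fintype.card_fin,
    nsmul_eq_mul]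
  push_cast
  field_simp
  ring

/-- A combination of deviations on which the star force acts as the linear restoring force `-β`
solves a homogeneous equation. -/
theorem IsStarSolution.isHomogeneousSolution_sum (hα : 0 < α) (hα1 : α ≤ 1)
    (hx : IsStarSolution μ F N α ω ε A₀ Ω₀ ξ x) (c : Fin (N + 1) → ℝ) (β : ℝ)
    (hc : ∀ t w, ∑ j, c j * starForce x j t w = -β * ∑ j, c j * deviation x j t w) :
    IsHomogeneousSolution μ F α (ω + ε * β) ξ (fun t w => ∑ j, c j * deviation x j t w) := by
  have hadm : IsAdmissible μ F (deviation x) := by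
    rw [deviation_eq_sum]
    exact hx.admissible.linearCombination _
  refine ⟨hadm.linearCombination fun _ => c, ?_⟩
  filter_upwards [hx.ae_caputoDeriv_deviation hα hα1, ae_all_iff.2 hadm.absolutelyContinuous]
    with w h1 h2
  filter_upwards [h1, ae_caputoDeriv_sum Finset.univ c hα hα1
    (x := fun j t => deviation x j t w) h2] with t h3 h4
  rw [h4]
  simp only [h3, mul_add, Finset.sum_add_distrib, mul_left_comm _ ε, mul_left_comm _ (-(ω + ξ t w)),
    ← Finset.mul_sum, hc]
  ring

theorem MeanTendstoZero.sub_mul {Δ Δ' : ℝ → Ω → ℝ} (h : MeanTendstoZero μ Δ)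
    (h' : MeanTendstoZero μ Δ') (c : ℝ) : MeanTendstoZero μ (fun t w => Δ t w - c * Δ' t w) := by
  refine ⟨fun t ht => (h.1 t ht).sub ((h'.1 t ht).const_mul c), ?_⟩
  have := h.2.sub (h'.2.const_mul c)
  rw [mul_zero, sub_zero] at this
  refine this.congr' ?_
  filter_upwards [eventually_ge_atTop 0] with t ht
  rw [integral_sub (h.1 t ht) ((h'.1 t ht).const_mul c), integral_const_mul]

theorem threshold_mono {s s' : ℝ} (hs : 0 ≤ s) (hss : s ≤ s') (hlam : 0 < lam) :
    s ^ 2 + lam ^ α * s ≤ s' ^ 2 + lam ^ α * s' :=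
  add_le_add (pow_le_pow_left₀ hs hss 2)
    (mul_le_mul_of_nonneg_left hss (Real.rpow_pos_of_pos hlam α).le)

/-- Below the global threshold every particle synchronizes in mean with the mean field. -/
theorem IsStarSolution.meanTendstoZero_deviation [IsProbabilityMeasure μ] (hα : 0 < α)
    (hα1 : α ≤ 1) (hω : 0 ≤ ω) (hε : 0 ≤ ε) (hσ : 0 < σ) (hlam : 0 < lam)
    (hξ : IsDichotomousNoise μ F σ lam ξ) (hx : IsStarSolution μ F N α ω ε A₀ Ω₀ ξ x)
    (hlt : σ ^ 2 < (ω + ε) ^ 2 + lam ^ α * (ω + ε)) (i : Fin (N + 1)) :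
    MeanTendstoZero μ (deviation x i) := by
  have hle : ω + ε ≤ ω + ε * ((N : ℝ) + 1) := by
    have := mul_nonneg hε (Nat.cast_nonneg (α := ℝ) N)
    linarith
  have hmain : MeanTendstoZero μ (deviation x 0) := by
    -- `Δ₀` alone is an eigenvector, with restoring constant `N + 1`.
    have h := hx.isHomogeneousSolution_sum hα hα1 (fun j => if j = 0 then 1 else 0)
      ((N : ℝ) + 1) (fun t w => by
        simp only [ite_mul, one_mul, zero_mul, Finset.sum_ite_eq', Finset.mem_univ, if_true]
        simp [starForce])
    simp only [ite_mul, one_mul, zero_mul, Finset.sum_ite_eq', Finset.mem_univ, if_true] at h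
    exact h.meanTendstoZero hξ hα hα1 hσ hlam (by linarith)
      (hlt.trans_le (threshold_mono (by linarith) hle hlam))
  refine Fin.cases hmain (fun k => ?_) i
  have hN : (N : ℝ) ≠ 0 := by
    have := k.pos
    positivity
  have hsum : ∀ y : Fin (N + 1) → ℝ, ∑ j, (if j = 0 then 1 / (N : ℝ) else
      if j = k.succ then 1 else 0) * y j = y k.succ + 1 / N * y 0 := by
    intro y
    rw [Fin.sum_univ_succ]
    simp only [if_true, Fin.succ_ne_zero, if_false, Fin.succ_inj, ite_mul, one_mul, zero_mul,
      Finset.sum_ite_eq', Finset.mem_univ]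
    ring
  -- `Δₖ + Δ₀/N` is an eigenvector with restoring constant `1`: the force on it is `Δ₀ - Δₖ -
  -- (N+1)Δ₀/N = -(Δₖ + Δ₀/N)`. Subtracting `Δ₀/N`, already known to vanish in mean, leaves `Δₖ`.
  have h := hx.isHomogeneousSolution_sum hα hα1
    (fun j => if j = 0 then 1 / (N : ℝ) else if j = k.succ then 1 else 0) 1 (fun t w => by
      rw [hsum fun j => starForce x j t w, hsum fun j => deviation x j t w]
      simp only [starForce, if_true, Fin.succ_ne_zero, if_false]
      field_simp
      ring)
  simp only [mul_one] at h
  have h' := (h.meanTendstoZero hξ hα hα1 hσ hlam (by linarith) hlt).sub_mul hmain (1 / N)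
  have e : (fun t w => ∑ j, (if j = 0 then 1 / (N : ℝ) else if j = k.succ then 1 else 0)
      * deviation x j t w - 1 / N * deviation x 0 t w) = deviation x k.succ := by
    ext t w
    rw [hsum fun j => deviation x j t w]
    ring
  rwa [e] at h'

end StarNetwork

theorem mainTheorem4 {Ω : Type*} {m : MeasurableSpace Ω} (μ : Measure Ω) [IsProbabilityMeasure μ]
    (F : Filtration ℝ m) (N : ℕ) (α ω ε A₀ Ω₀ σ lam : ℝ)
    (hα : 0 < α) (hα1 : α ≤ 1) (hω : 0 ≤ ω) (hε : 0 ≤ ε) (hσ : 0 < σ) (hlam : 0 < lam)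
    (ξ : ℝ → Ω → ℝ) (hξ : IsDichotomousNoise μ F σ lam ξ)
    (x : Fin (N + 1) → ℝ → Ω → ℝ) (hx : IsStarSolution μ F N α ω ε A₀ Ω₀ ξ x) :
    -- exact deviation equation; the residual is `ε` times the deviation of the main particle
    (∀ n : Fin N, ∀ᵐ w ∂μ, ∀ᵐ t ∂(volume.restrict (Set.Ici (0 : ℝ))),
      caputoDeriv α (fun s => deviation x n.succ s w) t
        + (ω + ξ t w + ε) * deviation x n.succ t w = ε * deviation x 0 t w) ∧
    -- whenever the main particle is on the mean field, the equation is homogeneous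
    (∀ n : Fin N, ∀ᵐ w ∂μ, ∀ᵐ t ∂(volume.restrict (Set.Ici (0 : ℝ))),
      x 0 t w = meanField x t w →
      caputoDeriv α (fun s => deviation x n.succ s w) t
        + (ω + ξ t w + ε) * deviation x n.succ t w = 0) ∧
    -- under the global condition, solutions of the homogeneous equation vanish in mean
    (σ ^ 2 < globalSyncThreshold α ω ε lam →
      ∀ Δ : ℝ → Ω → ℝ, IsHomogeneousSolution μ F α (ω + ε) ξ Δ → MeanTendstoZero μ Δ) ∧
    -- the global condition implies the synchronization criterion of the main particle
    (σ ^ 2 < globalSyncThreshold α ω ε lam →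
      σ ^ 2 < (ω + ε * ((N : ℝ) + 1)) ^ 2 + lam ^ α * (ω + ε * ((N : ℝ) + 1))) ∧
    -- under the global condition, every particle synchronizes in mean with the mean field
    (σ ^ 2 < globalSyncThreshold α ω ε lam →
      ∀ i : Fin (N + 1), MeanTendstoZero μ (deviation x i)) := by
  have hdev : ∀ n : Fin N, ∀ᵐ w ∂μ, ∀ᵐ t ∂(volume.restrict (Set.Ici (0 : ℝ))),
      caputoDeriv α (fun s => deviation x n.succ s w) t
        + (ω + ξ t w + ε) * deviation x n.succ t w = ε * deviation x 0 t w := by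
    intro n
    filter_upwards [hx.ae_caputoDeriv_deviation hα hα1] with w h
    filter_upwards [h] with t ht
    rw [ht n.succ, starForce, if_neg (Fin.succ_ne_zero n)]
    ring
  refine ⟨hdev, fun n => ?_, fun hlt Δ hΔ => ?_, fun hlt => ?_, fun hlt i => ?_⟩
  · filter_upwards [hdev n] with w h
    filter_upwards [h] with t ht h0
    rw [ht, deviation, h0, sub_self, mul_zero]
  · exact hΔ.meanTendstoZero hξ hα hα1 hσ hlam (by linarith) hlt
  · refine hlt.trans_le (threshold_mono (by linarith) ?_ hlam)
    have := mul_nonneg hε (Nat.cast_nonneg (α := ℝ) N)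
    linarith
  · exact hx.meanTendstoZero_deviation hα hα1 hω hε hσ hlam hξ hlt i
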